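/- Let $V=\{v_1,\dots,v_n\}$ with $n\ge 2$. An ordered constraint is an ordering $(u_1,\dots,u_s)$ of a subset of $V$ of size $s\ge 2$; a graph on $V$ satisfies it if for every $2\le i\le s$ there is some $1\le j<i$ such that $\{u_j,u_i\}$ is an edge of the graph. In Online Network Construction with Ordered Constraints, ordered constraints are given one at a time to an algorithm, which starts with no edges and must, after each constraint, have added edges (edges are never removed) so that all constraints given so far are satisfied. The cost is the total number of edges added, and $\mathrm{OPT}$ is the minimum number of edges of a graph on $V$ satisfying all the given constraints. Theorem. There is a deterministic online algorithm such that, whenever all the given constraints can be satisfied by a path, it adds at most $2n-3$ edges in total, and, if at least one constraint is given, strictly fewer than $2\cdot\mathrm{OPT}$ edges. In particular, on Online Network Construction with Ordered Constraints where an optimal solution is known to form a path, the competitive ratio has an asymptotic upper bound of $2$ (as $n\to\infty$). -/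

import Mathlib

/-- An ordered constraint on the vertex set `V`: an ordering `(v₁, …, vₛ)` of a subset of `V`
of size `s ≥ 2`, given as a list of pairwise distinct vertices. -/
structure OrderedConstraint (V : Type*) where
  /-- the vertices, in order -/
  verts : List V
  nodup : verts.Nodup
  two_le : 2 ≤ verts.length

/-- The graph `G` satisfies the ordered constraint `(v₁, …, vₛ)`: every vertex other than the
first is joined in `G` to at least one vertex that precedes it in the ordering. -/
def OrderedConstraint.SatisfiedBy {V : Type*} (c : OrderedConstraint V) (G : SimpleGraph V) :
    Prop :=
  ∀ (i : ℕ) (hi : i < c.verts.length), 1 ≤ i →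
    ∃ (j : ℕ) (hj : j < i), G.Adj (c.verts[j]'(hj.trans hi)) c.verts[i]

/-- `G` is a solution for a sequence of ordered constraints if it satisfies all of them. -/
def IsSolution {V : Type*} (σ : List (OrderedConstraint V)) (G : SimpleGraph V) : Prop :=
  ∀ c ∈ σ, c.SatisfiedBy G

/-- The cost of the best solution in hindsight: the least number of edges of a graph on `V`
that satisfies all the constraints of `σ`. -/
noncomputable def opt {V : Type*} (σ : List (OrderedConstraint V)) : ℕ :=
  sInf {k | ∃ G : SimpleGraph V, IsSolution σ G ∧ G.edgeSet.ncard = k}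

/-- The edges of `P` are exactly the edges of a single simple path (which may or may not pass
through all the vertices of `V`). -/
def IsPathGraph {V : Type*} (P : SimpleGraph V) : Prop :=
  ∃ (u v : V) (p : P.Walk u v), p.IsPath ∧ ∀ e ∈ P.edgeSet, e ∈ p.edges

/-- The constraint sequences that can be satisfied by a path. -/
def pathInstances (V : Type*) : Set (List (OrderedConstraint V)) :=
  {σ | ∃ P : SimpleGraph V, IsPathGraph P ∧ IsSolution σ P}

/-- A (deterministic) online algorithm for Network Construction with Ordered Constraints on the
vertex set `V`. `graph σ` is the graph that it holds after it has been given, one by one, the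
constraints of the list `σ` (and nothing else). It starts without edges, it never removes an
edge, and after each new constraint its graph satisfies all the constraints given so far. -/
structure OnlineAlgorithm (V : Type*) where
  /-- the graph held after the given history -/
  graph : List (OrderedConstraint V) → SimpleGraph V
  graph_nil : graph [] = ⊥
  graph_le : ∀ (σ : List (OrderedConstraint V)) (c : OrderedConstraint V),
    graph σ ≤ graph (σ ++ [c])
  isSolution : ∀ σ : List (OrderedConstraint V), IsSolution σ (graph σ)

/-- The cost of the algorithm on `σ`: the total number of edges that it has added. -/
noncomputable def OnlineAlgorithm.cost {V : Type*} (A : OnlineAlgorithm V)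
    (σ : List (OrderedConstraint V)) : ℕ :=
  (A.graph σ).edgeSet.ncard

/-- `A` is `r`-competitive on the class `I` of instances: on each instance in `I` with at least
one constraint, the cost of its solution is less than `r` times the optimum in hindsight. -/
def OnlineAlgorithm.IsCompetitiveOn {V : Type*} (A : OnlineAlgorithm V) (r : ℝ)
    (I : Set (List (OrderedConstraint V))) : Prop :=
  ∀ σ ∈ I, σ ≠ [] → (A.cost σ : ℝ) < r * (opt σ : ℝ)

/-! Suppose that a path satisfies the constraints, and number the vertices along it. Each initial
segment of a constraint grows by a neighbour of an earlier vertex, so it is an interval of this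
linear order. The algorithm does not know the order, but it can record what all such orders have in
common, in a forest resembling a PQ-tree: the roots are disjoint intervals, and each node is cut
into a list of children whose order is known up to reversal. Consecutive children are joined by an
edge between their anchors.

Let `I` be the part of a constraint already treated and `v` its next vertex. If `v` lies in another
root, the two roots are merged (`exists_join`). Nodes that overlap `insert v I` are then dissolved
into their parents, in the orientation that this interval forces (`exists_orientation`,
`exists_flatten`, `exists_resolve`). Once neither `I` nor `insert v I` overlaps a node, `{v}` is a
child of the smallest node containing `insert v I`, and the next child in the direction of `I` has
its anchor in `I`. The edge that the constraint demands is therefore already there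
(`Connects.exists_adj`).

The number of edges, plus the credits of the nodes, plus twice the number of roots, never exceeds
`2n`. A merger buys one edge and one credit with one root. A dissolved node pays for the junctions
at its two ends; an end that carries its anchor needs no new edge, so credit 1 suffices if the
anchor is at an end, and 2 otherwise. With `k` roots and at least one node, some credit is left, so
there are at most `2(n - k) - 1` edges. Every solution connects the vertices of each root, so `OPT ≥
n - k`. -/

/-! ### Intervals and aligned lists of blocks in a linear order. -/

/-- `J` is an interval of the linear order on `V` induced by `f`. -/
def OrderConvex {V : Type*} (f : V → ℤ) (J : Finset V) : Prop :=
  ∀ x ∈ J, ∀ z ∈ J, ∀ y, f x < f y → f y < f z → y ∈ J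

/-- All of `X` comes before all of `Y` in the order induced by `f`. -/
def Before {V : Type*} (f : V → ℤ) (X Y : Finset V) : Prop :=
  ∀ x ∈ X, ∀ y ∈ Y, f x < f y

/-- The blocks of the list `l` come in the order of `l`, or in the reverse order. -/
def Aligned {V : Type*} (f : V → ℤ) (l : List (Finset V)) : Prop :=
  l.Pairwise (Before f) ∨ l.Pairwise (Before (-f))

theorem before_neg {V : Type*} {f : V → ℤ} {X Y : Finset V} :
    Before (-f) X Y ↔ Before f Y X := by
  simp only [Before, Pi.neg_apply, neg_lt_neg_iff]
  exact ⟨fun h x hx y hy => h y hy x hx, fun h x hx y hy => h y hy x hx⟩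

theorem OrderConvex.neg {V : Type*} {f : V → ℤ} {J : Finset V} (h : OrderConvex f J) :
    OrderConvex (-f) J := by
  intro x hx z hz y h1 h2
  simp only [Pi.neg_apply, neg_lt_neg_iff] at h1 h2
  exact h z hz x hx y h2 h1

theorem pairwise_before_reverse {V : Type*} {f : V → ℤ} {l : List (Finset V)} :
    l.reverse.Pairwise (Before f) ↔ l.Pairwise (Before (-f)) := by
  rw [List.pairwise_reverse]
  exact ⟨fun h => h.imp before_neg.2, fun h => h.imp before_neg.1⟩

theorem Aligned.neg {V : Type*} {f : V → ℤ} {l : List (Finset V)} (h : Aligned f l) :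
    Aligned (-f) l := by
  unfold Aligned at *
  rw [neg_neg]
  exact h.symm

theorem Aligned.reverse {V : Type*} {f : V → ℤ} {l : List (Finset V)} (h : Aligned f l) :
    Aligned f l.reverse := by
  unfold Aligned at *
  rw [pairwise_before_reverse, pairwise_before_reverse, neg_neg]
  exact h.symm

/-- Convex sets that are disjoint and nonempty come one after the other. -/
theorem OrderConvex.before_or_before {V : Type*} {f : V → ℤ} (hf : Function.Injective f)
    {A B : Finset V} (hA : OrderConvex f A) (hB : OrderConvex f B) (hAB : Disjoint A B)
    (hAne : A.Nonempty) (hBne : B.Nonempty) : Before f A B ∨ Before f B A := by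
  have key : ∀ {A B : Finset V}, OrderConvex f A → OrderConvex f B → Disjoint A B →
      ∀ a ∈ A, ∀ b ∈ B, f a < f b → Before f A B := by
    intro A B hA hB hd a ha b hb hab x hx y hy
    by_contra hlt
    have hxy : f y < f x := lt_of_le_of_ne (not_lt.1 hlt) fun h =>
      Finset.disjoint_left.1 hd hx (hf h ▸ hy)
    -- Either `a < y < x` traps `y` in `A`, or `y < a < b` traps `a` in `B`.
    rcases lt_or_gt_of_ne (fun h => Finset.disjoint_left.1 hd ha (hf h ▸ hy) : f a ≠ f y) with h | h
    · exact Finset.disjoint_left.1 hd (hA a ha x hx y h hxy) hy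
    · exact Finset.disjoint_left.1 hd ha (hB y hy b hb a h hab)
  obtain ⟨a, ha⟩ := hAne
  obtain ⟨b, hb⟩ := hBne
  rcases lt_or_gt_of_ne (fun h => Finset.disjoint_left.1 hAB ha (hf h ▸ hb) : f a ≠ f b) with h | h
  · exact Or.inl (key hA hB hAB a ha b hb h)
  · exact Or.inr (key hB hA hAB.symm b hb a ha h)

/-- If `A`, `B` and `J` are convex and `J ⊆ A ∪ B` meets both `A` and `B`, then `A ∪ B` is
convex. -/
theorem OrderConvex.union {V : Type*} [DecidableEq V] {f : V → ℤ} (hf : Function.Injective f)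
    {A B J : Finset V} (hA : OrderConvex f A) (hB : OrderConvex f B) (hJ : OrderConvex f J)
    (hsub : J ⊆ A ∪ B) {a b : V} (ha : a ∈ A) (haJ : a ∈ J) (hb : b ∈ B) (hbJ : b ∈ J) :
    OrderConvex f (A ∪ B) := by
  have key : ∀ {A B : Finset V}, OrderConvex f A → OrderConvex f B → J ⊆ A ∪ B →
      ∀ a ∈ A, a ∈ J → ∀ b ∈ B, b ∈ J → ∀ x ∈ A, ∀ z ∈ B, ∀ y,
      (f x < f y ∧ f y < f z ∨ f z < f y ∧ f y < f x) → y ∈ A ∪ B := by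
    intro A B hA hB hs a ha haJ b hb hbJ x hx z hz y hy
    by_contra hyn
    have hyA : y ∉ A := fun h => hyn (Finset.mem_union_left _ h)
    have hyB : y ∉ B := fun h => hyn (Finset.mem_union_right _ h)
    have hyJ : y ∉ J := fun h => hyn (hs h)
    have ne : ∀ {w : V} {S : Finset V}, w ∈ S → y ∉ S → f w ≠ f y :=
      fun hw hy h => hy (hf h ▸ hw)
    have h1 := ne ha hyA
    have h2 := ne hb hyB
    -- A point `y` outside `A` and `B` has all of `A` on one side and all of `B` on one side. If it
    -- separates `x` from `z`, it separates `a` from `b`, and convexity of `J` puts it in `J`.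
    have c1 : f x < f y → f a < f y := fun h =>
      (lt_or_gt_of_ne h1).elim id fun h' => (hyA (hA x hx a ha y h h')).elim
    have c2 : f y < f x → f y < f a := fun h =>
      (lt_or_gt_of_ne h1).elim (fun h' => (hyA (hA a ha x hx y h' h)).elim) id
    have c3 : f z < f y → f b < f y := fun h =>
      (lt_or_gt_of_ne h2).elim id fun h' => (hyB (hB z hz b hb y h h')).elim
    have c4 : f y < f z → f y < f b := fun h =>
      (lt_or_gt_of_ne h2).elim (fun h' => (hyB (hB b hb z hz y h' h)).elim) id
    rcases hy with ⟨h, h'⟩ | ⟨h, h'⟩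
    · exact hyJ (hJ a haJ b hbJ y (c1 h) (c4 h'))
    · exact hyJ (hJ b hbJ a haJ y (c3 h) (c2 h'))
  intro x hx z hz y h1 h2
  rcases Finset.mem_union.1 hx with hx | hx <;> rcases Finset.mem_union.1 hz with hz | hz
  · exact Finset.mem_union_left _ (hA x hx z hz y h1 h2)
  · exact key hA hB hsub a ha haJ b hb hbJ x hx z hz y (Or.inl ⟨h1, h2⟩)
  · exact key hA hB hsub a ha haJ b hb hbJ z hz x hx y (Or.inr ⟨h1, h2⟩)
  · exact Finset.mem_union_right _ (hB x hx z hz y h1 h2)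

/-- In an aligned list, a block other than `Z` has a neighbour that is `Z` or lies between the
block and `Z`. -/
theorem Aligned.exists_neighbor {V : Type*} {f : V → ℤ} {l : List (Finset V)}
    {R : Finset V → Finset V → Prop} (hR : ∀ X Y, R X Y → R Y X) (hl : Aligned f l)
    (hc : l.IsChain R) {X Z : Finset V} (hX : X ∈ l) (hZ : Z ∈ l) (hXZ : X ≠ Z) :
    ∃ Y ∈ l, R X Y ∧ (Y = Z ∨ ∀ x ∈ X, ∀ y ∈ Y, ∀ z ∈ Z,
      (f x < f y ∧ f y < f z) ∨ (f z < f y ∧ f y < f x)) := by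
  have key : ∀ l1 l2 : List (Finset V), Aligned f (l1 ++ X :: l2) → (l1 ++ X :: l2).IsChain R →
      Z ∈ l2 → ∃ Y ∈ l2, R X Y ∧ (Y = Z ∨ ∀ x ∈ X, ∀ y ∈ Y, ∀ z ∈ Z,
      (f x < f y ∧ f y < f z) ∨ (f z < f y ∧ f y < f x)) := by
    intro l1 l2 hl hc hZ
    obtain _ | ⟨Y, l3⟩ := l2
    · simp at hZ
    refine ⟨Y, by simp, (List.isChain_append_cons_cons.1 hc).2.1, ?_⟩
    rcases List.mem_cons.1 hZ with h | h
    · exact Or.inl h.symm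
    refine Or.inr fun x hx y hy z hz => ?_
    rcases hl with hl | hl
    · have := (List.pairwise_append.1 hl).2.1
      rw [List.pairwise_cons, List.pairwise_cons] at this
      exact Or.inl ⟨this.1 Y (by simp) x hx y hy, this.2.1 Z h y hy z hz⟩
    · have := (List.pairwise_append.1 hl).2.1
      rw [List.pairwise_cons, List.pairwise_cons] at this
      exact Or.inr ⟨before_neg.1 (this.2.1 Z h) z hz y hy,
        before_neg.1 (this.1 Y (by simp)) y hy x hx⟩
  obtain ⟨l1, l2, rfl⟩ := List.append_of_mem hX
  simp only [List.mem_append, List.mem_cons] at hZ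
  rcases hZ with h | h | h
  · have hr : (l1 ++ X :: l2).reverse = l2.reverse ++ X :: l1.reverse := by simp
    obtain ⟨Y, hY, h'⟩ := key l2.reverse l1.reverse (hr ▸ hl.reverse)
      (hr ▸ List.isChain_reverse.2 (hc.imp fun a b hab => hR _ _ hab)) (by simpa using h)
    exact ⟨Y, by simp at hY; simp [hY], h'⟩
  · exact absurd h.symm hXZ
  · obtain ⟨Y, hY, h'⟩ := key l1 l2 hl hc h
    exact ⟨Y, by simp [hY], h'⟩

/-- An edge can be made available at the price of one edge. -/
theorem exists_le_adj {V : Type*} [Finite V] (G : SimpleGraph V) {s t : V} (hst : s ≠ t) :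
    ∃ G' : SimpleGraph V, G ≤ G' ∧ G'.Adj s t ∧ G'.edgeSet.ncard ≤ G.edgeSet.ncard + 1 := by
  refine ⟨G ⊔ SimpleGraph.fromEdgeSet {s(s, t)}, le_sup_left, by simp [hst], ?_⟩
  rw [SimpleGraph.edgeSet_sup]
  refine (Set.ncard_union_le _ _).trans (Nat.add_le_add_left ?_ _)
  calc _ ≤ ({s(s, t)} : Set (Sym2 V)).ncard :=
        Set.ncard_le_ncard (by rw [SimpleGraph.edgeSet_fromEdgeSet]; exact Set.sdiff_subset)
    _ = 1 := Set.ncard_singleton _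

/-! ### Block forests and their credits. -/

/-- A laminar family of blocks of vertices: `nodes` are the blocks of at least two vertices, and
`ch N` lists the maximal proper subblocks of the node `N`, in an order that is determined up to
reversal. The maximal blocks are the `roots`. Every block has a distinguished vertex. -/
structure BlockForest (V : Type*) where
  nodes : Finset (Finset V)
  roots : Finset (Finset V)
  ch : Finset V → List (Finset V)
  anchor : Finset V → V
  anchor_singleton : ∀ v, anchor {v} = v
  anchor_mem : ∀ N ∈ nodes, anchor N ∈ N
  two_le_ch : ∀ N ∈ nodes, 2 ≤ (ch N).length
  ch_disj : ∀ N ∈ nodes, (ch N).Pairwise Disjoint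
  mem_node : ∀ N ∈ nodes, ∀ v, v ∈ N ↔ ∃ X ∈ ch N, v ∈ X
  ch_block : ∀ N ∈ nodes, ∀ X ∈ ch N, X ∈ nodes ∨ ∃ v, X = {v}
  root_block : ∀ R ∈ roots, R ∈ nodes ∨ ∃ v, R = {v}
  root_or_child : ∀ M ∈ nodes, M ∈ roots ∨ ∃ N ∈ nodes, M ∈ ch N
  parent_unique : ∀ N ∈ nodes, ∀ N' ∈ nodes, ∀ X, X ∈ ch N → X ∈ ch N' → N = N'
  root_not_child : ∀ R ∈ roots, ∀ N ∈ nodes, R ∉ ch N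
  root_disj : ∀ R ∈ roots, ∀ R' ∈ roots, R ≠ R' → Disjoint R R'
  root_cover : ∀ v, ∃ R ∈ roots, v ∈ R
  node_le_root : ∀ N ∈ nodes, ∃ R ∈ roots, N ⊆ R

namespace BlockForest

variable {V : Type*}

/-- The order `f` is compatible with the forest. -/
def Realizes (F : BlockForest V) (f : V → ℤ) : Prop :=
  (∀ R ∈ F.roots, OrderConvex f R) ∧ ∀ N ∈ F.nodes, Aligned f (F.ch N)

/-- Consecutive children are joined in `G` at their anchors. -/
def Connects (F : BlockForest V) (G : SimpleGraph V) : Prop :=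
  ∀ N ∈ F.nodes, (F.ch N).IsChain fun X Y => G.Adj (F.anchor X) (F.anchor Y)

/-- `x` is the anchor of the first or the last block of `l`. -/
def IsEnd (a : Finset V → V) (l : List (Finset V)) (x : V) : Prop :=
  l.head?.map a = some x ∨ l.getLast?.map a = some x

open Classical in
/-- The credit of a node: `1`, and one more if its anchor is not that of an outer child. -/
noncomputable def credit (a : Finset V → V) (l : List (Finset V)) (x : V) : ℕ :=
  if IsEnd a l x then 1 else 2

/-- The total credit of a forest. -/
noncomputable def weight (F : BlockForest V) : ℕ :=
  ∑ N ∈ F.nodes, credit F.anchor (F.ch N) (F.anchor N)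

theorem one_le_credit (a : Finset V → V) (l : List (Finset V)) (x : V) : 1 ≤ credit a l x := by
  unfold credit; split <;> omega

theorem credit_le_two (a : Finset V → V) (l : List (Finset V)) (x : V) : credit a l x ≤ 2 := by
  unfold credit; split <;> omega

theorem anchor_mem_of_block (F : BlockForest V) {X : Finset V}
    (h : X ∈ F.nodes ∨ ∃ v, X = {v}) : F.anchor X ∈ X := by
  rcases h with h | ⟨v, rfl⟩
  · exact F.anchor_mem X h
  · simp [F.anchor_singleton]

theorem anchor_mem_of_mem_ch (F : BlockForest V) {N X : Finset V} (hN : N ∈ F.nodes)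
    (h : X ∈ F.ch N) : F.anchor X ∈ X :=
  F.anchor_mem_of_block (F.ch_block N hN X h)

theorem ch_subset (F : BlockForest V) {N X : Finset V} (hN : N ∈ F.nodes)
    (h : X ∈ F.ch N) : X ⊆ N :=
  fun v hv => (F.mem_node N hN v).2 ⟨X, h, hv⟩

theorem ch_disjoint (F : BlockForest V) {N X Y : Finset V} (hN : N ∈ F.nodes)
    (hX : X ∈ F.ch N) (hY : Y ∈ F.ch N) (hXY : X ≠ Y) : Disjoint X Y :=
  by
  have : Std.Symm (Disjoint : Finset V → Finset V → Prop) := ⟨fun _ _ h => h.symm⟩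
  exact (F.ch_disj N hN).forall hX hY hXY

theorem ch_nodup (F : BlockForest V) {N : Finset V} (hN : N ∈ F.nodes) : (F.ch N).Nodup := by
  refine List.Pairwise.imp_of_mem ?_ (F.ch_disj N hN)
  rintro X Y hX - h rfl
  exact Finset.disjoint_left.1 h (F.anchor_mem_of_mem_ch hN hX) (F.anchor_mem_of_mem_ch hN hX)

theorem exists_ne_ch (F : BlockForest V) {N : Finset V} (hN : N ∈ F.nodes) (X : Finset V) :
    ∃ Y ∈ F.ch N, Y ≠ X := by
  have h2 := F.two_le_ch N hN
  have hn := F.ch_nodup hN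
  generalize F.ch N = l at *
  match l, h2, hn with
  | A :: B :: l, _, hn =>
    by_cases h : A = X
    · refine ⟨B, by simp, ?_⟩
      rintro rfl
      simp [h] at hn
    · exact ⟨A, by simp, h⟩

/-- A second child exists, and it is disjoint from the first and nonempty because it contains its
anchor. Strictness drives the choices of largest and smallest nodes later on. -/
theorem ch_ssubset (F : BlockForest V) {N X : Finset V} (hN : N ∈ F.nodes)
    (h : X ∈ F.ch N) : X ⊂ N := by
  refine (Finset.ssubset_iff_subset_ne).2 ⟨F.ch_subset hN h, ?_⟩
  rintro rfl
  obtain ⟨Y, hY, hne⟩ := F.exists_ne_ch hN X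
  have := F.anchor_mem_of_mem_ch hN hY
  exact Finset.disjoint_left.1 (F.ch_disjoint hN hY h hne) this (F.ch_subset hN hY this)

end BlockForest

/-! ### Dissolving a node into its parent. -/

namespace BlockForest

variable {V : Type*}

theorem credit_reverse (a : Finset V → V) (l : List (Finset V)) (x : V) :
    credit a l.reverse x = credit a l x := by
  unfold credit
  congr 1
  simp only [IsEnd, List.head?_reverse, List.getLast?_reverse, or_comm]

open Classical in
theorem credit_eq {a : Finset V → V} {l : List (Finset V)} {P Q : Finset V}
    (hP : l.head? = some P) (hQ : l.getLast? = some Q) (x : V) :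
    credit a l x = if a P = x ∨ a Q = x then 1 else 2 := by
  simp only [credit, IsEnd, hP, hQ, Option.map_some, Option.some.injEq]

/-- Splicing a list of blocks into another one, in place of a block `M`, so that consecutive
blocks remain joined at their anchors: the new edges are paid for by the credits. -/
theorem exists_isChain_splice [Finite V] (G : SimpleGraph V) (a : Finset V → V)
    {l1 l2 l' : List (Finset V)} {M : Finset V} (x : V)
    (hN : (l1 ++ M :: l2).IsChain fun X Y => G.Adj (a X) (a Y))
    (hM : l'.IsChain fun X Y => G.Adj (a X) (a Y))
    (h12 : l1 ≠ [] ∨ l2 ≠ []) (hl' : l' ≠ [])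
    (hne1 : ∀ X ∈ l1, ∀ Y ∈ l', a X ≠ a Y) (hne2 : ∀ X ∈ l2, ∀ Y ∈ l', a X ≠ a Y) :
    ∃ G' : SimpleGraph V, G ≤ G' ∧
      ((l1 ++ l' ++ l2).IsChain fun X Y => G'.Adj (a X) (a Y)) ∧
      G'.edgeSet.ncard + credit a (l1 ++ l' ++ l2) x ≤
        G.edgeSet.ncard + (credit a (l1 ++ M :: l2) x + credit a l' (a M)) := by
  classical
  obtain ⟨P, hP⟩ : ∃ P, l'.head? = some P := by
    cases l' with
    | nil => exact absurd rfl hl'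
    | cons P t => exact ⟨P, rfl⟩
  obtain ⟨Q, hQ⟩ : ∃ Q, l'.getLast? = some Q := ⟨_, List.getLast?_eq_some_getLast hl'⟩
  have hPm : P ∈ l' := List.mem_of_mem_head? hP
  have hQm : Q ∈ l' := List.mem_of_mem_getLast? hQ
  obtain ⟨hN1, hN2, hN3⟩ := List.isChain_append.1 hN
  -- If `P` has the anchor of `M`, the edge that joined `M` to its left neighbour still serves;
  -- otherwise one edge is bought. The right end is symmetric.
  have left : ∃ G1 : SimpleGraph V, G ≤ G1 ∧ (∀ X ∈ l1.getLast?, G1.Adj (a X) (a P)) ∧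
      G1.edgeSet.ncard ≤ G.edgeSet.ncard + (if l1 = [] ∨ a P = a M then 0 else 1) := by
    rcases List.eq_nil_or_concat l1 with h | ⟨m, Z, h⟩
    · exact ⟨G, le_rfl, by simp [h], by simp⟩
    · subst h
      by_cases hPM : a P = a M
      · refine ⟨G, le_rfl, ?_, by simp⟩
        rw [hPM]
        exact fun X hX => hN3 X hX M (by simp)
      · obtain ⟨G1, h1, h2, h3⟩ := exists_le_adj G (hne1 Z (by simp) P hPm)
        exact ⟨G1, h1, by simpa using h2, by simpa [hPM] using h3⟩
  obtain ⟨G1, hG1, hadj1, hc1⟩ := left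
  have right : ∃ G2 : SimpleGraph V, G1 ≤ G2 ∧ (∀ X ∈ l2.head?, G2.Adj (a Q) (a X)) ∧
      G2.edgeSet.ncard ≤ G1.edgeSet.ncard + (if l2 = [] ∨ a Q = a M then 0 else 1) := by
    cases l2 with
    | nil => exact ⟨G1, le_rfl, by simp, by simp⟩
    | cons Z m =>
      by_cases hQM : a Q = a M
      · refine ⟨G1, le_rfl, ?_, by simp⟩
        rw [hQM]
        simpa using hG1 (List.isChain_cons_cons.1 hN2).1
      · obtain ⟨G2, h1, h2, h3⟩ := exists_le_adj G1 (hne2 Z (by simp) Q hQm)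
        exact ⟨G2, h1, by simpa using h2.symm, by simpa [hQM] using h3⟩
  obtain ⟨G2, hG2, hadj2, hc2⟩ := right
  have hG := hG1.trans hG2
  refine ⟨G2, hG, ?_, ?_⟩
  · refine List.IsChain.append (List.IsChain.append (hN1.imp fun _ _ h => hG h)
      (hM.imp fun _ _ h => hG h) ?_) ((List.isChain_cons.1 hN2).2.imp fun _ _ h => hG h) ?_
    · intro X hX Y hY
      rw [hP] at hY
      cases hY
      exact hG2 (hadj1 X hX)
    · intro X hX Y hY
      rw [List.getLast?_append, hQ] at hX
      cases hX
      exact hadj2 Y hY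
  · have hM1 := one_le_credit a l' (a M)
    have hM2 := credit_le_two a l' (a M)
    have hN1 := one_le_credit a (l1 ++ M :: l2) x
    have hN2 := credit_le_two a (l1 ++ l' ++ l2) x
    -- If `M` is an inner child, there are two junctions, and the credit of `l'` covers those that
    -- are not free. If `M` is an outer child, there is one junction, but the credit of the parent
    -- may rise by one; this requires that the new outer block lacks the anchor of `M`, so the rise
    -- takes the place of the missing junction.
    have key : credit a (l1 ++ l' ++ l2) x + (if l1 = [] ∨ a P = a M then 0 else 1) +
        (if l2 = [] ∨ a Q = a M then 0 else 1) ≤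
        credit a (l1 ++ M :: l2) x + credit a l' (a M) := by
      rcases l1 with _ | ⟨A, m1⟩ <;> rcases List.eq_nil_or_concat l2 with rfl | ⟨m2, B, rfl⟩
      · simp at h12
      · have e1 : ([] ++ l' ++ m2.concat B).head? = some P := by simp [hP]
        have e2 : ([] ++ l' ++ m2.concat B).getLast? = some B := by simp
        have e3 : ([] ++ M :: m2.concat B).head? = some M := by simp
        have e4 : ([] ++ M :: m2.concat B).getLast? = some B := by
          rw [List.nil_append, List.concat_eq_append, ← List.cons_append, List.getLast?_concat]
        rw [credit_eq e1 e2, credit_eq e3 e4, credit_eq hP hQ]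
        simp
        grind
      · have e1 : (A :: m1 ++ l' ++ []).head? = some A := by simp
        have e2 : (A :: m1 ++ l' ++ []).getLast? = some Q := by
          rw [List.append_nil, List.getLast?_append, hQ, Option.some_or]
        have e3 : (A :: m1 ++ [M]).head? = some A := by simp
        have e4 : (A :: m1 ++ [M]).getLast? = some M := List.getLast?_concat
        rw [credit_eq e1 e2, credit_eq e3 e4, credit_eq hP hQ]
        simp
        grind
      · have e1 : (A :: m1 ++ l' ++ m2.concat B).head? = some A := by simp
        have e2 : (A :: m1 ++ l' ++ m2.concat B).getLast? = some B := by
          rw [List.concat_eq_append, ← List.append_assoc, List.getLast?_concat]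
        have e3 : (A :: m1 ++ M :: m2.concat B).head? = some A := by simp
        have e4 : (A :: m1 ++ M :: m2.concat B).getLast? = some B := by
          rw [List.concat_eq_append, ← List.cons_append, ← List.append_assoc,
            List.getLast?_concat]
        rw [credit_eq e1 e2, credit_eq e3 e4, credit_eq hP hQ]
        simp
        grind
    omega

/-- This unspent unit is what makes the final bound strict. -/
theorem weight_pos (F : BlockForest V) {N : Finset V} (hN : N ∈ F.nodes) : 1 ≤ F.weight :=
  (one_le_credit _ _ _).trans <|
    Finset.single_le_sum (f := fun N => credit F.anchor (F.ch N) (F.anchor N))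
      (fun _ _ => Nat.zero_le _) hN

/-- The forest in which the children of the node `M` become children of the parent `N` of `M`, in
the place of `M`. -/
def flatten [DecidableEq V] (F : BlockForest V) {N M : Finset V} {l1 l2 l' : List (Finset V)}
    (hN : N ∈ F.nodes) (hM : M ∈ F.nodes) (hl : F.ch N = l1 ++ M :: l2)
    (hl' : l'.Perm (F.ch M)) : BlockForest V :=
  have hMN : M ∈ F.ch N := by simp [hl]
  have hNM : N ≠ M := by
    rintro rfl
    exact (F.ch_ssubset hN hMN).ne rfl
  have hnd : (l1 ++ M :: l2).Nodup := hl ▸ F.ch_nodup hN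
  have hmem : ∀ X, X ∈ l1 ++ l' ++ l2 ↔ (X ∈ F.ch N ∧ X ≠ M) ∨ X ∈ F.ch M := by
    intro X
    have h1 : M ∉ l1 ++ l2 := (List.nodup_middle.1 hnd).notMem
    rw [← hl'.mem_iff, hl]
    simp only [List.mem_append, List.mem_cons] at h1 ⊢
    by_cases hX : X = M
    · subst hX
      tauto
    · tauto
  have hup : ∀ N' ∈ F.nodes.erase M, ∀ X,
      X ∈ Function.update F.ch N (l1 ++ l' ++ l2) N' ↔
        (X ∈ F.ch N' ∧ X ≠ M) ∨ (N' = N ∧ X ∈ F.ch M) := by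
    intro N' hN' X
    by_cases h : N' = N
    · subst h
      simp [hmem, -List.append_assoc]
    · have : X ∈ F.ch N' → X ≠ M := by
        rintro h' rfl
        exact h (F.parent_unique N' (Finset.mem_of_mem_erase hN') N hN _ h' hMN)
      simp only [Function.update_of_ne h, h, false_and, or_false]
      tauto
  { nodes := F.nodes.erase M
    roots := F.roots
    ch := Function.update F.ch N (l1 ++ l' ++ l2)
    anchor := F.anchor
    anchor_singleton := F.anchor_singleton
    anchor_mem := fun N' h => F.anchor_mem N' (Finset.mem_of_mem_erase h)
    two_le_ch := by
      intro N' hN'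
      by_cases h : N' = N
      · subst h
        have := F.two_le_ch M hM
        simp only [Function.update_self, List.length_append, hl'.length_eq]
        omega
      · rw [Function.update_of_ne h]
        exact F.two_le_ch N' (Finset.mem_of_mem_erase hN')
    ch_disj := by
      intro N' hN'
      by_cases h : N' = N
      · subst h
        have h1 := F.ch_disj N' hN
        have h2 := F.ch_disj M hM
        have h3 : l'.Pairwise Disjoint := (hl'.pairwise_iff fun h => h.symm).2 h2
        rw [hl] at h1
        simp only [Function.update_self, List.pairwise_append, List.pairwise_cons,
          List.mem_append, List.mem_cons] at h1 ⊢
        have h4 : ∀ X ∈ l', X ⊆ M := fun X hX => F.ch_subset hM (hl'.mem_iff.1 hX)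
        refine ⟨⟨h1.1, h3, fun X hX Y hY => ?_⟩, h1.2.1.2, ?_⟩
        · exact (h1.2.2 X hX M (Or.inl rfl)).mono_right (h4 Y hY)
        · rintro X (hX | hX) Y hY
          · exact h1.2.2 X hX Y (Or.inr hY)
          · exact (h1.2.1.1 Y hY).mono_left (h4 X hX)
      · rw [Function.update_of_ne h]
        exact F.ch_disj N' (Finset.mem_of_mem_erase hN')
    mem_node := by
      intro N' hN' v
      rw [F.mem_node N' (Finset.mem_of_mem_erase hN')]
      simp only [hup N' hN']
      constructor
      · rintro ⟨X, hX, hv⟩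
        by_cases h : X = M
        · subst h
          obtain ⟨Y, hY, hv⟩ := (F.mem_node X hM v).1 hv
          exact ⟨Y, Or.inr ⟨F.parent_unique N' (Finset.mem_of_mem_erase hN') N hN _ hX hMN, hY⟩, hv⟩
        · exact ⟨X, Or.inl ⟨hX, h⟩, hv⟩
      · rintro ⟨X, ⟨hX, -⟩ | ⟨rfl, hX⟩, hv⟩
        · exact ⟨X, hX, hv⟩
        · exact ⟨M, hMN, F.ch_subset hM hX hv⟩
    ch_block := by
      intro N' hN' X hX
      rcases (hup N' hN' X).1 hX with ⟨hX, h⟩ | ⟨-, hX⟩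
      · exact (F.ch_block N' (Finset.mem_of_mem_erase hN') X hX).imp_left fun h' =>
          Finset.mem_erase.2 ⟨h, h'⟩
      · exact (F.ch_block M hM X hX).imp_left fun h' =>
          Finset.mem_erase.2 ⟨(F.ch_ssubset hM hX).ne, h'⟩
    root_block := by
      intro R hR
      refine (F.root_block R hR).imp_left fun h => Finset.mem_erase.2 ⟨?_, h⟩
      rintro rfl
      exact F.root_not_child R hR N hN hMN
    root_or_child := by
      intro X hX
      refine (F.root_or_child X (Finset.mem_of_mem_erase hX)).imp_right ?_
      rintro ⟨N', hN', h⟩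
      by_cases hN'M : N' = M
      · subst hN'M
        have hN2 := Finset.mem_erase.2 ⟨hNM, hN⟩
        exact ⟨N, hN2, (hup N hN2 X).2 (Or.inr ⟨rfl, h⟩)⟩
      · have hN2 := Finset.mem_erase.2 ⟨hN'M, hN'⟩
        exact ⟨N', hN2, (hup N' hN2 X).2 (Or.inl ⟨h, Finset.ne_of_mem_erase hX⟩)⟩
    parent_unique := by
      intro N1 h1 N2 h2 X hX1 hX2
      have k1 := Finset.mem_erase.1 h1
      have k2 := Finset.mem_erase.1 h2
      rcases (hup N1 h1 X).1 hX1 with ⟨j1, -⟩ | ⟨rfl, j1⟩ <;>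
        rcases (hup N2 h2 X).1 hX2 with ⟨j2, -⟩ | ⟨rfl, j2⟩
      · exact F.parent_unique N1 k1.2 N2 k2.2 X j1 j2
      · exact absurd (F.parent_unique N1 k1.2 M hM X j1 j2) k1.1
      · exact absurd (F.parent_unique N2 k2.2 M hM X j2 j1) k2.1
      · rfl
    root_not_child := by
      intro R hR N' hN' h
      rcases (hup N' hN' R).1 h with ⟨h, -⟩ | ⟨-, h⟩
      · exact F.root_not_child R hR N' (Finset.mem_of_mem_erase hN') h
      · exact F.root_not_child R hR M hM h
    root_disj := F.root_disj
    root_cover := F.root_cover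
    node_le_root := fun N' h => F.node_le_root N' (Finset.mem_of_mem_erase h) }

/-- Flattening a node costs at most the credit that it sets free. -/
theorem exists_flatten [DecidableEq V] [Finite V] (F : BlockForest V) (G : SimpleGraph V)
    {N M : Finset V} {l1 l2 l' : List (Finset V)} (hN : N ∈ F.nodes) (hM : M ∈ F.nodes)
    (hl : F.ch N = l1 ++ M :: l2) (hl' : l' = F.ch M ∨ l' = (F.ch M).reverse)
    (hG : F.Connects G) :
    ∃ (F' : BlockForest V) (G' : SimpleGraph V), F'.nodes = F.nodes.erase M ∧
      F'.roots = F.roots ∧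
      (∀ f, F.Realizes f → Aligned f (l1 ++ l' ++ l2) → F'.Realizes f) ∧
      G ≤ G' ∧ F'.Connects G' ∧
      G'.edgeSet.ncard + F'.weight ≤ G.edgeSet.ncard + F.weight := by
  have hperm : l'.Perm (F.ch M) := by
    rcases hl' with rfl | rfl
    · exact List.Perm.refl _
    · exact List.reverse_perm _
  have hMN : M ∈ F.ch N := by simp [hl]
  have hNM : N ≠ M := by
    rintro rfl
    exact (F.ch_ssubset hN hMN).ne rfl
  have hchain : l'.IsChain fun X Y => G.Adj (F.anchor X) (F.anchor Y) := by
    rcases hl' with rfl | rfl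
    · exact hG M hM
    · exact List.isChain_reverse.2 ((hG M hM).imp fun _ _ h => h.symm)
  have hcredit : credit F.anchor l' (F.anchor M) = credit F.anchor (F.ch M) (F.anchor M) := by
    rcases hl' with rfl | rfl
    · rfl
    · exact credit_reverse _ _ _
  have h12 : l1 ≠ [] ∨ l2 ≠ [] := by
    have := F.two_le_ch N hN
    rw [hl] at this
    by_contra! h
    simp [h.1, h.2] at this
  have hne : ∀ X ∈ F.ch N, X ≠ M → ∀ Y ∈ l', F.anchor X ≠ F.anchor Y := by
    intro X hX hXM Y hY h
    have hY' := hperm.mem_iff.1 hY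
    refine Finset.disjoint_left.1 (F.ch_disjoint hN hX hMN hXM) (F.anchor_mem_of_mem_ch hN hX) ?_
    rw [h]
    exact F.ch_subset hM hY' (F.anchor_mem_of_mem_ch hM hY')
  have h1 : M ∉ l1 ++ l2 := (List.nodup_middle.1 (hl ▸ F.ch_nodup hN)).notMem
  rw [List.mem_append, not_or] at h1
  obtain ⟨G', hGG', hch, hcost⟩ := exists_isChain_splice G F.anchor (F.anchor N)
    (hl ▸ hG N hN) hchain h12
    (by
      rintro rfl
      have := F.two_le_ch M hM
      rw [← hperm.length_eq] at this
      simp at this)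
    (fun X hX => hne X (by simp [hl, hX]) fun h => h1.1 (h ▸ hX))
    (fun X hX => hne X (by simp [hl, hX]) fun h => h1.2 (h ▸ hX))
  refine ⟨F.flatten hN hM hl hperm, G', rfl, rfl, ?_, hGG', ?_, ?_⟩
  · intro f hf hal
    refine ⟨hf.1, fun N' hN' => ?_⟩
    change Aligned f (Function.update F.ch N _ N')
    by_cases h : N' = N
    · subst h
      rwa [Function.update_self]
    · rw [Function.update_of_ne h]
      exact hf.2 N' (Finset.mem_of_mem_erase hN')
  · intro N' hN'
    change (Function.update F.ch N _ N').IsChain _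
    by_cases h : N' = N
    · subst h
      rwa [Function.update_self]
    · rw [Function.update_of_ne h]
      exact (hG N' (Finset.mem_of_mem_erase hN')).imp fun _ _ h => hGG' h
  · have hN2 : N ∈ F.nodes.erase M := Finset.mem_erase.2 ⟨hNM, hN⟩
    have e1 : F.weight = credit F.anchor (F.ch M) (F.anchor M) +
        (credit F.anchor (F.ch N) (F.anchor N) +
          ∑ N' ∈ (F.nodes.erase M).erase N, credit F.anchor (F.ch N') (F.anchor N')) := by
      rw [Finset.add_sum_erase _ (fun N' => credit F.anchor (F.ch N') (F.anchor N')) hN2,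
        Finset.add_sum_erase _ (fun N' => credit F.anchor (F.ch N') (F.anchor N')) hM]
      rfl
    have e2 : (F.flatten hN hM hl hperm).weight =
        credit F.anchor (l1 ++ l' ++ l2) (F.anchor N) +
          ∑ N' ∈ (F.nodes.erase M).erase N, credit F.anchor (F.ch N') (F.anchor N') := by
      change ∑ N' ∈ F.nodes.erase M,
        credit F.anchor (Function.update F.ch N (l1 ++ l' ++ l2) N') (F.anchor N') = _
      rw [← Finset.add_sum_erase _ _ hN2, Function.update_self]
      congr 1
      refine Finset.sum_congr rfl fun N' hN' => ?_
      rw [Function.update_of_ne (Finset.ne_of_mem_erase hN')]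
    rw [e1, e2, hl]
    rw [hcredit] at hcost
    omega

/-! ### Merging two roots. -/

/-- The forest in which the roots `A` and `B` become the children of a new root. -/
def join [DecidableEq V] (F : BlockForest V) {A B : Finset V} (hA : A ∈ F.roots)
    (hB : B ∈ F.roots) (hAB : A ≠ B) : BlockForest V :=
  have hd := F.root_disj A hA B hB hAB
  have hAa := F.anchor_mem_of_block (F.root_block A hA)
  have hBa := F.anchor_mem_of_block (F.root_block B hB)
  -- A root containing `A ∪ B` would meet both roots and so equal both. Hence `A ∪ B` is a new
  -- block, and the updates below leave the data of the old nodes intact.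
  have hroot : ∀ R ∈ F.roots, A ∪ B ⊆ R → False := by
    intro R hR h
    have h1 : A = R := by
      by_contra hne
      exact Finset.disjoint_left.1 (F.root_disj A hA R hR hne) hAa
        (h (Finset.mem_union_left _ hAa))
    have h2 : B = R := by
      by_contra hne
      exact Finset.disjoint_left.1 (F.root_disj B hB R hR hne) hBa
        (h (Finset.mem_union_right _ hBa))
    exact hAB (h1.trans h2.symm)
  have hnew : A ∪ B ∉ F.nodes := by
    intro h
    obtain ⟨R, hR, h⟩ := F.node_le_root _ h
    exact hroot R hR h
  have hch : ∀ N ∈ F.nodes, Function.update F.ch (A ∪ B) [A, B] N = F.ch N := fun N hN =>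
    Function.update_of_ne (fun h : N = A ∪ B => hnew (h ▸ hN)) _ _
  have hnch : ∀ N ∈ F.nodes, A ∪ B ∉ F.ch N := by
    intro N hN h
    obtain ⟨R, hR, h'⟩ := F.node_le_root _ hN
    exact hroot R hR ((F.ch_subset hN h).trans h')
  { nodes := insert (A ∪ B) F.nodes
    roots := insert (A ∪ B) ((F.roots.erase A).erase B)
    ch := Function.update F.ch (A ∪ B) [A, B]
    -- `A` is an outer child, so with its anchor the new node needs only one unit of credit.
    anchor := Function.update F.anchor (A ∪ B) (F.anchor A)
    anchor_singleton := by
      intro v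
      by_cases h : ({v} : Finset V) = A ∪ B
      · have h1 : F.anchor A ∈ ({v} : Finset V) := h ▸ Finset.mem_union_left _ hAa
        have h2 : F.anchor B ∈ ({v} : Finset V) := h ▸ Finset.mem_union_right _ hBa
        rw [Finset.mem_singleton] at h1 h2
        exact absurd (h2 ▸ hBa) (Finset.disjoint_left.1 hd (h1 ▸ hAa))
      · rw [Function.update_of_ne h, F.anchor_singleton]
    anchor_mem := by
      intro N hN
      rcases Finset.mem_insert.1 hN with rfl | hN
      · rw [Function.update_self]
        exact Finset.mem_union_left _ hAa
      · rw [Function.update_of_ne (fun h : N = A ∪ B => hnew (h ▸ hN))]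
        exact F.anchor_mem N hN
    two_le_ch := by
      intro N hN
      rcases Finset.mem_insert.1 hN with rfl | hN
      · simp
      · rw [hch N hN]
        exact F.two_le_ch N hN
    ch_disj := by
      intro N hN
      rcases Finset.mem_insert.1 hN with rfl | hN
      · simpa using hd
      · rw [hch N hN]
        exact F.ch_disj N hN
    mem_node := by
      intro N hN v
      rcases Finset.mem_insert.1 hN with rfl | hN
      · simp
      · rw [hch N hN]
        exact F.mem_node N hN v
    ch_block := by
      intro N hN X hX
      rcases Finset.mem_insert.1 hN with rfl | hN
      · simp only [Function.update_self, List.mem_cons, List.not_mem_nil, or_false] at hX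
        rcases hX with rfl | rfl
        · exact (F.root_block _ hA).imp_left (Finset.mem_insert_of_mem ·)
        · exact (F.root_block _ hB).imp_left (Finset.mem_insert_of_mem ·)
      · rw [hch N hN] at hX
        exact (F.ch_block N hN X hX).imp_left (Finset.mem_insert_of_mem ·)
    root_block := by
      intro R hR
      rcases Finset.mem_insert.1 hR with rfl | hR
      · exact Or.inl (Finset.mem_insert_self _ _)
      · exact (F.root_block R (Finset.mem_of_mem_erase (Finset.mem_of_mem_erase hR))).imp_left
          (Finset.mem_insert_of_mem ·)
    root_or_child := by
      intro M hM
      rcases Finset.mem_insert.1 hM with rfl | hM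
      · exact Or.inl (Finset.mem_insert_self _ _)
      · rcases F.root_or_child M hM with h | ⟨N, hN, h⟩
        · by_cases hMA : M = A
          · exact Or.inr ⟨A ∪ B, Finset.mem_insert_self _ _, by simp [hMA]⟩
          · by_cases hMB : M = B
            · exact Or.inr ⟨A ∪ B, Finset.mem_insert_self _ _, by simp [hMB]⟩
            · exact Or.inl (Finset.mem_insert_of_mem
                (Finset.mem_erase.2 ⟨hMB, Finset.mem_erase.2 ⟨hMA, h⟩⟩))
        · exact Or.inr ⟨N, Finset.mem_insert_of_mem hN, by rwa [hch N hN]⟩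
    parent_unique := by
      intro N hN N' hN' X hX hX'
      have aux : ∀ N ∈ F.nodes, X ∈ F.ch N → X ∈ [A, B] → False := by
        intro N₀ hN₀ hX₀ h
        simp only [List.mem_cons, List.not_mem_nil, or_false] at h
        rcases h with rfl | rfl
        · exact F.root_not_child _ hA N₀ hN₀ hX₀
        · exact F.root_not_child _ hB N₀ hN₀ hX₀
      rcases Finset.mem_insert.1 hN with rfl | hN <;>
        rcases Finset.mem_insert.1 hN' with rfl | hN'
      · rfl
      · rw [Function.update_self] at hX
        rw [hch N' hN'] at hX'
        exact (aux N' hN' hX' hX).elim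
      · rw [Function.update_self] at hX'
        rw [hch N hN] at hX
        exact (aux N hN hX hX').elim
      · rw [hch N hN] at hX
        rw [hch N' hN'] at hX'
        exact F.parent_unique N hN N' hN' X hX hX'
    root_not_child := by
      intro R hR N hN h
      rcases Finset.mem_insert.1 hN with rfl | hN
      · simp only [Function.update_self, List.mem_cons, List.not_mem_nil, or_false] at h
        rcases Finset.mem_insert.1 hR with rfl | hR
        · rcases h with h | h
          · exact hroot A hA h.subset
          · exact hroot B hB h.subset
        · rcases h with rfl | rfl <;> simp at hR
      · rw [hch N hN] at h
        rcases Finset.mem_insert.1 hR with rfl | hR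
        · exact hnch N hN h
        · exact F.root_not_child R (Finset.mem_of_mem_erase (Finset.mem_of_mem_erase hR)) N hN h
    root_disj := by
      have aux : ∀ R ∈ (F.roots.erase A).erase B, Disjoint (A ∪ B) R := by
        intro R hR
        simp only [Finset.mem_erase] at hR
        exact Finset.disjoint_union_left.2 ⟨F.root_disj A hA R hR.2.2 (Ne.symm hR.2.1),
          F.root_disj B hB R hR.2.2 (Ne.symm hR.1)⟩
      intro R hR R' hR' hne
      rcases Finset.mem_insert.1 hR with rfl | hR <;>
        rcases Finset.mem_insert.1 hR' with rfl | hR'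
      · exact absurd rfl hne
      · exact aux R' hR'
      · exact (aux R hR).symm
      · exact F.root_disj R (Finset.mem_of_mem_erase (Finset.mem_of_mem_erase hR)) R'
          (Finset.mem_of_mem_erase (Finset.mem_of_mem_erase hR')) hne
    root_cover := by
      intro v
      obtain ⟨R, hR, hv⟩ := F.root_cover v
      by_cases hRA : R = A
      · exact ⟨A ∪ B, Finset.mem_insert_self _ _, Finset.mem_union_left _ (hRA ▸ hv)⟩
      · by_cases hRB : R = B
        · exact ⟨A ∪ B, Finset.mem_insert_self _ _, Finset.mem_union_right _ (hRB ▸ hv)⟩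
        · exact ⟨R, Finset.mem_insert_of_mem
            (Finset.mem_erase.2 ⟨hRB, Finset.mem_erase.2 ⟨hRA, hR⟩⟩), hv⟩
    node_le_root := by
      intro N hN
      rcases Finset.mem_insert.1 hN with rfl | hN
      · exact ⟨A ∪ B, Finset.mem_insert_self _ _, le_rfl⟩
      · obtain ⟨R, hR, hv⟩ := F.node_le_root N hN
        by_cases hRA : R = A
        · exact ⟨A ∪ B, Finset.mem_insert_self _ _,
            (hRA ▸ hv).trans Finset.subset_union_left⟩
        · by_cases hRB : R = B
          · exact ⟨A ∪ B, Finset.mem_insert_self _ _,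
              (hRB ▸ hv).trans Finset.subset_union_right⟩
          · exact ⟨R, Finset.mem_insert_of_mem
              (Finset.mem_erase.2 ⟨hRB, Finset.mem_erase.2 ⟨hRA, hR⟩⟩), hv⟩ }

/-- Joining two roots costs one edge and adds one to the credit. -/
theorem exists_join [DecidableEq V] [Finite V] (F : BlockForest V) (G : SimpleGraph V)
    {A B : Finset V} (hA : A ∈ F.roots) (hB : B ∈ F.roots) (hAB : A ≠ B) (hG : F.Connects G) :
    ∃ (F' : BlockForest V) (G' : SimpleGraph V), F'.nodes = insert (A ∪ B) F.nodes ∧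
      F'.roots = insert (A ∪ B) ((F.roots.erase A).erase B) ∧
      F'.roots.card + 1 = F.roots.card ∧
      (∀ f, F.Realizes f → OrderConvex f (A ∪ B) → Aligned f [A, B] → F'.Realizes f) ∧
      G ≤ G' ∧ F'.Connects G' ∧
      G'.edgeSet.ncard + F'.weight ≤ G.edgeSet.ncard + F.weight + 2 := by
  have hAa := F.anchor_mem_of_block (F.root_block A hA)
  have hBa := F.anchor_mem_of_block (F.root_block B hB)
  have hd := F.root_disj A hA B hB hAB
  have hroot : ∀ X, (X ∈ F.roots ∨ ∃ N ∈ F.nodes, X ⊆ N) → X ≠ A ∪ B := by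
    rintro X h rfl
    obtain ⟨R, hR, h⟩ : ∃ R ∈ F.roots, A ∪ B ⊆ R := by
      rcases h with h | ⟨N, hN, h⟩
      · exact ⟨_, h, le_rfl⟩
      · obtain ⟨R, hR, h'⟩ := F.node_le_root N hN
        exact ⟨R, hR, h.trans h'⟩
    have h1 : A = R := by
      by_contra hne
      exact Finset.disjoint_left.1 (F.root_disj A hA R hR hne) hAa
        (h (Finset.mem_union_left _ hAa))
    have h2 : B = R := by
      by_contra hne
      exact Finset.disjoint_left.1 (F.root_disj B hB R hR hne) hBa
        (h (Finset.mem_union_right _ hBa))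
    exact hAB (h1.trans h2.symm)
  have hnode : ∀ N ∈ F.nodes, N ≠ A ∪ B := fun N hN => hroot N (Or.inr ⟨N, hN, le_rfl⟩)
  have hanch : ∀ N ∈ F.nodes, ∀ X ∈ F.ch N,
      (F.join hA hB hAB).anchor X = F.anchor X := fun N hN X hX =>
    Function.update_of_ne (hroot X (Or.inr ⟨N, hN, F.ch_subset hN hX⟩)) _ _
  have hanchN : ∀ N ∈ F.nodes, (F.join hA hB hAB).anchor N = F.anchor N := fun N hN =>
    Function.update_of_ne (hnode N hN) _ _
  have hanchA : (F.join hA hB hAB).anchor A = F.anchor A :=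
    Function.update_of_ne (hroot A (Or.inl hA)) _ _
  have hanchB : (F.join hA hB hAB).anchor B = F.anchor B :=
    Function.update_of_ne (hroot B (Or.inl hB)) _ _
  have hch : ∀ N ∈ F.nodes, (F.join hA hB hAB).ch N = F.ch N := fun N hN =>
    Function.update_of_ne (hnode N hN) _ _
  have hchAB : (F.join hA hB hAB).ch (A ∪ B) = [A, B] := Function.update_self _ _ _
  obtain ⟨G', hGG', hadj, hcard⟩ := exists_le_adj G (s := F.anchor A) (t := F.anchor B)
    fun h => Finset.disjoint_left.1 hd hAa (h ▸ hBa)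
  refine ⟨F.join hA hB hAB, G', rfl, rfl, ?_, ?_, hGG', ?_, ?_⟩
  · change (insert (A ∪ B) ((F.roots.erase A).erase B)).card + 1 = _
    rw [Finset.card_insert_of_notMem, Finset.card_erase_of_mem, Finset.card_erase_of_mem hA]
    · have : 1 < F.roots.card := Finset.one_lt_card.2 ⟨A, hA, B, hB, hAB⟩
      omega
    · exact Finset.mem_erase.2 ⟨hAB.symm, hB⟩
    · intro h
      exact hroot _ (Or.inl (Finset.mem_of_mem_erase (Finset.mem_of_mem_erase h))) rfl
  · intro f hf hc hal
    refine ⟨fun R hR => ?_, fun N hN => ?_⟩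
    · rcases Finset.mem_insert.1 hR with rfl | hR
      · exact hc
      · exact hf.1 R (Finset.mem_of_mem_erase (Finset.mem_of_mem_erase hR))
    · rcases Finset.mem_insert.1 hN with rfl | hN
      · rwa [hchAB]
      · rw [hch N hN]
        exact hf.2 N hN
  · intro N hN
    rcases Finset.mem_insert.1 hN with rfl | hN
    · rw [hchAB]
      simpa [hanchA, hanchB] using hadj
    · rw [hch N hN]
      refine List.IsChain.imp_of_mem_imp ?_ (hG N hN)
      intro X Y hX hY h
      rw [hanch N hN X hX, hanch N hN Y hY]
      exact hGG' h
  · have e : (F.join hA hB hAB).weight = 1 + F.weight := by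
      change ∑ N ∈ insert (A ∪ B) F.nodes, _ = _
      rw [Finset.sum_insert fun h => hnode _ h rfl]
      congr 1
      · rw [hchAB, credit, if_pos]
        left
        rw [List.head?_cons, Option.map_some, hanchA]
        exact congrArg some (show (F.join hA hB hAB).anchor (A ∪ B) = F.anchor A from
          Function.update_self _ _ _).symm
      · refine Finset.sum_congr rfl fun N hN => ?_
        rw [hch N hN, hanchN N hN]
        unfold credit IsEnd
        have hh : (F.ch N).head?.map (F.join hA hB hAB).anchor = (F.ch N).head?.map F.anchor :=
          Option.map_congr fun X hX => hanch N hN X (List.mem_of_mem_head? hX)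
        have ht : (F.ch N).getLast?.map (F.join hA hB hAB).anchor =
            (F.ch N).getLast?.map F.anchor :=
          Option.map_congr fun X hX => hanch N hN X (List.mem_of_mem_getLast? hX)
        rw [hh, ht]
    rw [e]
    omega

end BlockForest

/-! ### Making a new interval compatible with the forest. -/

/-- `M` meets `J`, and neither contains the other. -/
def Overlaps {V : Type*} (M J : Finset V) : Prop :=
  (∃ x ∈ M, x ∈ J) ∧ ¬M ⊆ J ∧ ¬J ⊆ M

namespace BlockForest

variable {V : Type*}

theorem Realizes.neg {F : BlockForest V} {f : V → ℤ} (h : F.Realizes f) : F.Realizes (-f) :=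
  ⟨fun R hR => (h.1 R hR).neg, fun N hN => (h.2 N hN).neg⟩

/-- If a convex set `J` overlaps the node `M` and contains a vertex `y` of the parent of `M` that
is not in `M`, then `J` determines the orientation of `M` relative to its parent. -/
theorem exists_orientation (F : BlockForest V) {N M J : Finset V} {l1 l2 : List (Finset V)}
    (hN : N ∈ F.nodes) (hM : M ∈ F.nodes) (hl : F.ch N = l1 ++ M :: l2) (hMJ : Overlaps M J)
    {y : V} (hyJ : y ∈ J) (hyN : y ∈ N) (hyM : y ∉ M)
    {f₀ : V → ℤ} (hf₀ : F.Realizes f₀) (hJ₀ : OrderConvex f₀ J) :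
    ∃ l', (l' = F.ch M ∨ l' = (F.ch M).reverse) ∧
      ∀ f, F.Realizes f → OrderConvex f J → Aligned f (l1 ++ l' ++ l2) := by
  -- All conditions are invariant under negating an order. So `f₀`, and later `f`, may be taken
  -- increasing along the children of `N`, and only the direction of `M` is in question.
  wlog hasc : (F.ch N).Pairwise (Before f₀) generalizing f₀
  · exact this hf₀.neg hJ₀.neg ((hf₀.2 N hN).resolve_left hasc)
  obtain ⟨l', hl', hasc'⟩ : ∃ l', (l' = F.ch M ∨ l' = (F.ch M).reverse) ∧
      l'.Pairwise (Before f₀) := by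
    rcases hf₀.2 M hM with h | h
    · exact ⟨_, Or.inl rfl, h⟩
    · exact ⟨_, Or.inr rfl, pairwise_before_reverse.2 h⟩
  have hmem : ∀ X, X ∈ l' ↔ X ∈ F.ch M := by
    rcases hl' with rfl | rfl <;> simp
  refine ⟨l', hl', fun f hf hJ => ?_⟩
  wlog hfasc : (F.ch N).Pairwise (Before f) generalizing f
  · have := (this (-f) hf.neg hJ.neg ((hf.2 N hN).resolve_left hfasc)).neg
    rwa [neg_neg] at this
  have hal : Aligned f l' := by
    rcases hl' with rfl | rfl
    · exact hf.2 M hM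
    · exact (hf.2 M hM).reverse
  have hl'asc : l'.Pairwise (Before f) := by
    rcases hal with h | hdesc
    · exact h
    exfalso
    have hpair : ∀ D ∈ F.ch M, ∀ D' ∈ F.ch M, D ≠ D' →
        (Before f₀ D D' ∧ Before f D' D) ∨ (Before f₀ D' D ∧ Before f D D') := by
      intro D hD D' hD' hne
      have : Std.Symm (fun X Y => (Before f₀ X Y ∧ Before f Y X) ∨
        (Before f₀ Y X ∧ Before f X Y)) := ⟨fun _ _ h => h.symm⟩
      have hp : l'.Pairwise (fun X Y => (Before f₀ X Y ∧ Before f Y X) ∨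
          (Before f₀ Y X ∧ Before f X Y)) :=
        (hasc'.and hdesc).imp fun h => Or.inl ⟨h.1, before_neg.1 h.2⟩
      exact hp.forall ((hmem D).2 hD) ((hmem D').2 hD') hne
    obtain ⟨D, hD, D', hD', hne, x, hxD, hxJ, w, hwD, hwJ⟩ : ∃ D ∈ F.ch M, ∃ D' ∈ F.ch M,
        D ≠ D' ∧ ∃ x ∈ D, x ∈ J ∧ ∃ w ∈ D', w ∉ J := by
      obtain ⟨⟨x, hxM, hxJ⟩, hMJ, -⟩ := hMJ
      obtain ⟨w, hwM, hwJ⟩ := Finset.not_subset.1 hMJ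
      obtain ⟨D, hD, hxD⟩ := (F.mem_node M hM x).1 hxM
      obtain ⟨D', hD', hwD⟩ := (F.mem_node M hM w).1 hwM
      -- If `x` and `w` share a child, the anchor of any other child replaces one of them, according
      -- to whether it lies in `J`.
      by_cases hne : D = D'
      · subst hne
        obtain ⟨E, hE, hED⟩ := F.exists_ne_ch hM D
        have hzE := F.anchor_mem_of_mem_ch hM hE
        by_cases hzJ : F.anchor E ∈ J
        · exact ⟨E, hE, D, hD, hED, _, hzE, hzJ, w, hwD, hwJ⟩
        · exact ⟨D, hD, E, hE, hED.symm, x, hxD, hxJ, _, hzE, hzJ⟩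
      · exact ⟨D, hD, D', hD', hne, x, hxD, hxJ, w, hwD, hwJ⟩
    have hwM : w ∈ M := F.ch_subset hM hD' hwD
    obtain ⟨Z, hZ, hyZ⟩ := (F.mem_node N hN y).1 hyN
    have hside : (∀ u ∈ M, f₀ u < f₀ y ∧ f u < f y) ∨ (∀ u ∈ M, f₀ y < f₀ u ∧ f y < f u) := by
      rw [hl] at hZ hasc hfasc
      simp only [List.pairwise_append, List.pairwise_cons, List.mem_append, List.mem_cons]
        at hZ hasc hfasc
      rcases hZ with h | rfl | h
      · exact Or.inr fun u hu => ⟨hasc.2.2 Z h M (Or.inl rfl) y hyZ u hu,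
          hfasc.2.2 Z h M (Or.inl rfl) y hyZ u hu⟩
      · exact absurd hyZ hyM
      · exact Or.inl fun u hu => ⟨hasc.2.1.1 Z h u hu y hyZ, hfasc.2.1.1 Z h u hu y hyZ⟩
    -- The vertex `y` is on the same side of `M` in both orders, while `D` and `D'` are exchanged.
    -- In one of the two orders `w` lies between `x` and `y`, against the convexity of `J`.
    rcases hside with h | h <;> rcases hpair D hD D' hD' hne with ⟨h1, h2⟩ | ⟨h1, h2⟩
    · exact hwJ (hJ₀ x hxJ y hyJ w (h1 x hxD w hwD) (h w hwM).1)
    · exact hwJ (hJ x hxJ y hyJ w (h2 x hxD w hwD) (h w hwM).2)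
    · exact hwJ (hJ y hyJ x hxJ w (h w hwM).2 (h2 w hwD x hxD))
    · exact hwJ (hJ₀ y hyJ x hxJ w (h w hwM).1 (h1 w hwD x hxD))
  left
  have hsub : ∀ X ∈ l', X ⊆ M := fun X hX => F.ch_subset hM ((hmem X).1 hX)
  rw [hl] at hfasc
  simp only [List.pairwise_append, List.pairwise_cons, List.mem_append, List.mem_cons]
    at hfasc ⊢
  refine ⟨⟨hfasc.1, hl'asc, fun X hX Y hY x hx y hy => ?_⟩, hfasc.2.1.2, ?_⟩
  · exact hfasc.2.2 X hX M (Or.inl rfl) x hx y (hsub Y hY hy)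
  · rintro X (hX | hX) Y hY
    · exact hfasc.2.2 X hX Y (Or.inr hY)
    · exact fun x hx y hy => hfasc.2.1.1 Y hY x (hsub X hX hx) y hy

/-- A set that is convex in all the orders in question can be made compatible with the forest at
no cost in excess of the credit. -/
theorem exists_resolve [DecidableEq V] [Finite V] (F : BlockForest V) (G : SimpleGraph V)
    {J : Finset V} {Φ : Set (V → ℤ)} (hΦ : Φ.Nonempty)
    (hF : ∀ f ∈ Φ, F.Realizes f) (hJ : ∀ f ∈ Φ, OrderConvex f J) (hG : F.Connects G)
    {R : Finset V} (hR : R ∈ F.roots) (hJR : J ⊆ R) :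
    ∃ (F' : BlockForest V) (G' : SimpleGraph V), F'.nodes ⊆ F.nodes ∧ F'.roots = F.roots ∧
      (∀ f ∈ Φ, F'.Realizes f) ∧ G ≤ G' ∧ F'.Connects G' ∧
      G'.edgeSet.ncard + F'.weight ≤ G.edgeSet.ncard + F.weight ∧
      ∀ M ∈ F'.nodes, ¬Overlaps M J := by
  induction hn : F.nodes.card using Nat.strong_induction_on generalizing F G with
  | _ n ih =>
  classical
  by_cases hno : ∀ M ∈ F.nodes, ¬Overlaps M J
  · exact ⟨F, G, subset_rfl, rfl, hF, le_rfl, hG, le_rfl, hno⟩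
  push Not at hno
  obtain ⟨M₀, hM₀, hMJ₀⟩ := hno
  -- For an overlapping node of largest size the parent does not overlap `J`, and so contains it.
  -- This supplies the vertex `y` that fixes the orientation. A parent exists because the only root
  -- meeting `J` is `R`, which contains `J`.
  obtain ⟨M, hMmem, hmax⟩ := Finset.exists_max_image (F.nodes.filter (Overlaps · J)) Finset.card
    ⟨M₀, Finset.mem_filter.2 ⟨hM₀, hMJ₀⟩⟩
  obtain ⟨hM, hMJ⟩ := Finset.mem_filter.1 hMmem
  obtain ⟨N, hN, hMN⟩ : ∃ N ∈ F.nodes, M ∈ F.ch N := by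
    refine (F.root_or_child M hM).resolve_left fun h => hMJ.2.2 ?_
    obtain ⟨x, hxM, hxJ⟩ := hMJ.1
    have : M = R := by
      by_contra hne
      exact Finset.disjoint_left.1 (F.root_disj M h R hR hne) hxM (hJR hxJ)
    rwa [this]
  have hss := F.ch_ssubset hN hMN
  have hJN : J ⊆ N := by
    by_contra hJN
    have hov : Overlaps N J := by
      obtain ⟨x, hxM, hxJ⟩ := hMJ.1
      exact ⟨⟨x, hss.subset hxM, hxJ⟩, fun h => hMJ.2.1 (hss.subset.trans h), hJN⟩
    exact absurd (hmax N (Finset.mem_filter.2 ⟨hN, hov⟩)) (Finset.card_lt_card hss).not_ge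
  obtain ⟨y, hyJ, hyM⟩ := Finset.not_subset.1 hMJ.2.2
  obtain ⟨l1, l2, hl⟩ := List.append_of_mem hMN
  obtain ⟨f₀, hf₀⟩ := hΦ
  obtain ⟨l', hl', hor⟩ := F.exists_orientation hN hM hl hMJ hyJ (hJN hyJ) hyM (hF f₀ hf₀)
    (hJ f₀ hf₀)
  obtain ⟨F₁, G₁, hn₁, hr₁, hF₁, hGG₁, hG₁, hc₁⟩ := F.exists_flatten G hN hM hl hl' hG
  obtain ⟨F₂, G₂, hn₂, hr₂, hF₂, hGG₂, hG₂, hc₂, hno₂⟩ := ih F₁.nodes.card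
    (by rw [← hn, hn₁]; exact Finset.card_erase_lt_of_mem hM) F₁ G₁
    (fun f hf => hF₁ f (hF f hf) (hor f (hF f hf) (hJ f hf))) hG₁ (hr₁ ▸ hR) rfl
  exact ⟨F₂, G₂, hn₂.trans (hn₁ ▸ Finset.erase_subset _ _), hr₂.trans hr₁, hF₂,
    hGG₁.trans hGG₂, hG₂, hc₂.trans hc₁, hno₂⟩

/-- If `I` and `insert v I` are compatible with the forest, then `v` is already joined to `I`. -/
theorem Connects.exists_adj [DecidableEq V] {F : BlockForest V} {G : SimpleGraph V}
    (hG : F.Connects G) {I R : Finset V} {v : V} (hI : I.Nonempty) (hv : v ∉ I)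
    (hR : R ∈ F.roots) (hJR : insert v I ⊆ R) (hIno : ∀ M ∈ F.nodes, ¬Overlaps M I)
    (hJno : ∀ M ∈ F.nodes, ¬Overlaps M (insert v I)) {f : V → ℤ} (hf : F.Realizes f)
    (hJ : OrderConvex f (insert v I)) : (∃ N ∈ F.nodes, insert v I ⊆ N) ∧ ∃ u ∈ I, G.Adj u v := by
  obtain ⟨u₀, hu₀⟩ := hI
  have hne₀ : u₀ ≠ v := fun h => hv (h ▸ hu₀)
  have hRn : R ∈ F.nodes := by
    refine (F.root_block R hR).resolve_right ?_
    rintro ⟨w, rfl⟩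
    have h1 := Finset.mem_singleton.1 (hJR (Finset.mem_insert_self v I))
    have h2 := Finset.mem_singleton.1 (hJR (Finset.mem_insert_of_mem hu₀))
    exact hne₀ (h2.trans h1.symm)
  refine ⟨⟨R, hRn, hJR⟩, ?_⟩
  -- By minimality no child of `N` that is a node contains `insert v I`; as none overlaps it either,
  -- each child meeting `insert v I` lies inside it.
  obtain ⟨N, hNmem, hmin⟩ := Finset.exists_min_image (F.nodes.filter (insert v I ⊆ ·)) Finset.card
    ⟨R, Finset.mem_filter.2 ⟨hRn, hJR⟩⟩
  obtain ⟨hN, hJN⟩ := Finset.mem_filter.1 hNmem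
  have hnotsub : ∀ X ∈ F.ch N, X ∈ F.nodes → ¬insert v I ⊆ X := fun X hX hXn h =>
    absurd (hmin X (Finset.mem_filter.2 ⟨hXn, h⟩))
      (Finset.card_lt_card (F.ch_ssubset hN hX)).not_ge
  have hsub : ∀ X ∈ F.ch N, ∀ x ∈ X, x ∈ insert v I → X ⊆ insert v I := by
    intro X hX x hx hxJ
    rcases F.ch_block N hN X hX with hXn | ⟨w, rfl⟩
    · by_contra h
      exact hJno X hXn ⟨⟨x, hx, hxJ⟩, h, hnotsub X hX hXn⟩
    · rw [Finset.mem_singleton] at hx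
      subst hx
      exact Finset.singleton_subset_iff.2 hxJ
  obtain ⟨X, hX, hvX⟩ := (F.mem_node N hN v).1 (hJN (Finset.mem_insert_self v I))
  -- A larger child around `v` would meet `I`, would not lie in `I`, and could not contain `I`
  -- without containing `insert v I`. It would overlap `I`.
  have hXv : X = {v} := by
    rcases F.ch_block N hN X hX with hXn | ⟨w, rfl⟩
    · refine Finset.eq_singleton_iff_unique_mem.2 ⟨hvX, fun w hw => ?_⟩
      by_contra hwv
      have hwI : w ∈ I := (Finset.mem_insert.1
        (hsub X hX v hvX (Finset.mem_insert_self v I) hw)).resolve_left hwv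
      refine hIno X hXn ⟨⟨w, hw, hwI⟩, fun h => hv (h hvX), fun h => hnotsub X hX hXn ?_⟩
      exact Finset.insert_subset hvX h
    · rw [Finset.mem_singleton.1 hvX]
  subst hXv
  obtain ⟨Z, hZ, huZ⟩ := (F.mem_node N hN u₀).1 (hJN (Finset.mem_insert_of_mem hu₀))
  have hvZ : ({v} : Finset V) ≠ Z := by
    rintro rfl
    exact hne₀ (Finset.mem_singleton.1 huZ)
  -- The neighbour of `{v}` on the way to the child of `u₀` is that child or lies between the two,
  -- so convexity puts its anchor in `insert v I`.
  obtain ⟨Y, hY, hadj, hbet⟩ := (hf.2 N hN).exists_neighbor (fun _ _ h => h.symm) (hG N hN) hX hZ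
    hvZ
  rw [F.anchor_singleton] at hadj
  have hYm := F.anchor_mem_of_mem_ch hN hY
  have hYJ : F.anchor Y ∈ insert v I := by
    rcases hbet with rfl | hbet
    · exact hsub Y hY u₀ huZ (Finset.mem_insert_of_mem hu₀) hYm
    · rcases hbet v hvX _ hYm u₀ huZ with ⟨h1, h2⟩ | ⟨h1, h2⟩
      · exact hJ v (Finset.mem_insert_self v I) u₀ (Finset.mem_insert_of_mem hu₀) _ h1 h2
      · exact hJ u₀ (Finset.mem_insert_of_mem hu₀) v (Finset.mem_insert_self v I) _ h1 h2
  exact ⟨F.anchor Y, (Finset.mem_insert.1 hYJ).resolve_left hadj.ne', hadj.symm⟩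

/-! ### The invariant and the online step. -/

/-- The forest records what is known about the orders in `Φ` and the graphs in `Ψ`, and the graph
`G` joins its blocks at a cost that is accounted for. -/
structure Invariant [Fintype V] (Φ : Set (V → ℤ)) (Ψ : Set (SimpleGraph V)) (F : BlockForest V)
    (G : SimpleGraph V) : Prop where
  realizes : ∀ f ∈ Φ, F.Realizes f
  connects : F.Connects G
  cost : G.edgeSet.ncard + F.weight + 2 * F.roots.card ≤ 2 * Fintype.card V
  reachable : ∀ H ∈ Ψ, ∀ R ∈ F.roots, ∀ x ∈ R, ∀ y ∈ R, H.Reachable x y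

/-- The online step for one more vertex `v` of a constraint of which the vertices in `I` have been
dealt with. -/
theorem Invariant.exists_extend [DecidableEq V] [Fintype V] {Φ : Set (V → ℤ)}
    {Ψ : Set (SimpleGraph V)} {F : BlockForest V} {G : SimpleGraph V} (h : F.Invariant Φ Ψ G)
    (hΦ : Φ.Nonempty) (hinj : ∀ f ∈ Φ, Function.Injective f) {I A : Finset V} {v : V}
    (hI : I.Nonempty) (hv : v ∉ I) (hA : A ∈ F.roots) (hIA : I ⊆ A)
    (hIno : ∀ M ∈ F.nodes, ¬Overlaps M I) (hJ : ∀ f ∈ Φ, OrderConvex f (insert v I))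
    (hΨ : ∀ H ∈ Ψ, ∃ u ∈ I, H.Adj u v) :
    ∃ (F' : BlockForest V) (G' : SimpleGraph V), G ≤ G' ∧ F'.Invariant Φ Ψ G' ∧
      (∃ R ∈ F'.roots, insert v I ⊆ R) ∧ (∀ M ∈ F'.nodes, ¬Overlaps M (insert v I)) ∧
      (∃ N ∈ F'.nodes, insert v I ⊆ N) ∧ ∃ u ∈ I, G'.Adj u v := by
  obtain ⟨F₁, G₁, R, hGG₁, h₁, hR, hJR, hno₁⟩ : ∃ (F₁ : BlockForest V) (G₁ : SimpleGraph V)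
      (R : Finset V), G ≤ G₁ ∧ F₁.Invariant Φ Ψ G₁ ∧ R ∈ F₁.roots ∧ insert v I ⊆ R ∧
      ∀ M ∈ F₁.nodes, ¬Overlaps M I := by
    by_cases hvA : v ∈ A
    · exact ⟨F, G, A, le_rfl, h, hA, Finset.insert_subset hvA hIA, hIno⟩
    -- The interval `insert v I` meets both `A` and `B`, so their union is an interval in every
    -- order. Every solution joins `v` to `I`, so the merged root stays connected in it.
    obtain ⟨B, hB, hvB⟩ := F.root_cover v
    have hAB : A ≠ B := by
      rintro rfl
      exact hvA hvB
    obtain ⟨u, hu⟩ := hI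
    obtain ⟨F₁, G₁, hn₁, hr₁, hcard, hF₁, hGG₁, hG₁, hc₁⟩ := F.exists_join G hA hB hAB h.connects
    have hsub : insert v I ⊆ A ∪ B := Finset.insert_subset (Finset.mem_union_right _ hvB)
      (hIA.trans Finset.subset_union_left)
    have hd := F.root_disj A hA B hB hAB
    refine ⟨F₁, G₁, A ∪ B, hGG₁, ⟨?_, hG₁, ?_, ?_⟩, ?_, hsub, ?_⟩
    · intro f hf
      have hr := (h.realizes f hf).1
      refine hF₁ f (h.realizes f hf) ?_ ?_
      · exact (hr A hA).union (hinj f hf) (hr B hB) (hJ f hf) hsub (hIA hu)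
          (Finset.mem_insert_of_mem hu) hvB (Finset.mem_insert_self v I)
      · rcases (hr A hA).before_or_before (hinj f hf) (hr B hB) hd ⟨u, hIA hu⟩ ⟨v, hvB⟩ with h | h
        · exact Or.inl (by simpa using h)
        · exact Or.inr (by simpa [before_neg] using h)
    · have := h.cost
      omega
    · intro H hH S hS
      rw [hr₁] at hS
      rcases Finset.mem_insert.1 hS with rfl | hS
      · obtain ⟨w, hw, hadj⟩ := hΨ H hH
        have hto : ∀ x ∈ A ∪ B, H.Reachable x v := by
          intro x hx
          rcases Finset.mem_union.1 hx with hx | hx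
          · exact (h.reachable H hH A hA x hx w (hIA hw)).trans hadj.reachable
          · exact h.reachable H hH B hB x hx v hvB
        exact fun x hx y hy => (hto x hx).trans (hto y hy).symm
      · exact h.reachable H hH S (Finset.mem_of_mem_erase (Finset.mem_of_mem_erase hS))
    · rw [hr₁]
      exact Finset.mem_insert_self _ _
    · intro M hM
      rw [hn₁] at hM
      rcases Finset.mem_insert.1 hM with rfl | hM
      · exact fun hov => hov.2.2 (hIA.trans Finset.subset_union_left)
      · exact hIno M hM
  obtain ⟨F₂, G₂, hn₂, hr₂, hF₂, hGG₂, hG₂, hc₂, hno₂⟩ := F₁.exists_resolve G₁ hΦ h₁.realizes hJ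
    h₁.connects hR hJR
  obtain ⟨f₀, hf₀⟩ := hΦ
  have hadj := hG₂.exists_adj hI hv (hr₂ ▸ hR) hJR (fun M hM => hno₁ M (hn₂ hM)) hno₂
    (hF₂ f₀ hf₀) (hJ f₀ hf₀)
  refine ⟨F₂, G₂, hGG₁.trans hGG₂, ⟨hF₂, hG₂, ?_, ?_⟩, ⟨R, hr₂ ▸ hR, hJR⟩, hno₂, hadj⟩
  · have := h₁.cost
    rw [hr₂]
    omega
  · rw [hr₂]
    exact h₁.reachable

theorem toFinset_take_succ [DecidableEq V] {l : List V} {i : ℕ} (hi : i < l.length) :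
    (l.take (i + 1)).toFinset = insert l[i] (l.take i).toFinset := by
  rw [List.take_add_one, List.getElem?_eq_getElem hi, Option.toList_some, List.toFinset_append,
    List.toFinset_cons, List.toFinset_nil, insert_empty_eq, Finset.union_comm]
  rfl

/-- The online step for a whole constraint. -/
theorem Invariant.exists_satisfiedBy [DecidableEq V] [Fintype V] {Φ : Set (V → ℤ)}
    {Ψ : Set (SimpleGraph V)} {F : BlockForest V} {G : SimpleGraph V} (h : F.Invariant Φ Ψ G)
    (hΦ : Φ.Nonempty) (hinj : ∀ f ∈ Φ, Function.Injective f) (c : OrderedConstraint V)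
    (hc : ∀ f ∈ Φ, ∀ i, OrderConvex f (c.verts.take i).toFinset)
    (hΨ : ∀ H ∈ Ψ, c.SatisfiedBy H) :
    ∃ (F' : BlockForest V) (G' : SimpleGraph V), G ≤ G' ∧ F'.Invariant Φ Ψ G' ∧
      c.SatisfiedBy G' ∧ F'.nodes.Nonempty := by
  have hlen := c.two_le
  have key : ∀ i, i + 1 ≤ c.verts.length → ∃ (F' : BlockForest V) (G' : SimpleGraph V),
      G ≤ G' ∧ F'.Invariant Φ Ψ G' ∧
      (∃ R ∈ F'.roots, (c.verts.take (i + 1)).toFinset ⊆ R) ∧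
      (∀ M ∈ F'.nodes, ¬Overlaps M (c.verts.take (i + 1)).toFinset) ∧
      (1 ≤ i → F'.nodes.Nonempty) ∧
      ∀ (k : ℕ) (hk : k < c.verts.length), 1 ≤ k → k < i + 1 →
        ∃ (j : ℕ) (hj : j < k), G'.Adj (c.verts[j]'(hj.trans hk)) c.verts[k] := by
    intro i
    induction i with
    | zero =>
      -- A prefix of length one is a singleton, which no block overlaps.
      intro hi
      have e : (c.verts.take (0 + 1)).toFinset = {c.verts[0]} := by
        rw [toFinset_take_succ hi]
        simp
      refine ⟨F, G, le_rfl, h, ?_, ?_, by omega, by omega⟩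
      · obtain ⟨R, hR, hv⟩ := F.root_cover c.verts[0]
        exact ⟨R, hR, by rw [e]; exact Finset.singleton_subset_iff.2 hv⟩
      · rw [e]
        rintro M - ⟨⟨x, hxM, hx⟩, -, h⟩
        rw [Finset.mem_singleton] at hx
        exact h (Finset.singleton_subset_iff.2 (hx ▸ hxM))
    | succ i ih =>
      intro hi
      obtain ⟨F₁, G₁, hGG₁, h₁, ⟨R, hR, hIR⟩, hno, -, hadj⟩ := ih (by omega)
      have hi' : i + 1 < c.verts.length := hi
      have hconv := fun f hf => hc f hf (i + 1 + 1)
      simp only [toFinset_take_succ hi'] at hconv ⊢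
      have hget : ∀ u ∈ (c.verts.take (i + 1)).toFinset,
          ∃ (j : ℕ) (hj : j < i + 1), c.verts[j]'(hj.trans hi') = u := by
        intro u hu
        rw [List.mem_toFinset, List.mem_take_iff_getElem] at hu
        obtain ⟨j, hj, rfl⟩ := hu
        exact ⟨j, by omega, rfl⟩
      have hmemI : ∀ (j : ℕ) (hj : j < i + 1),
          c.verts[j]'(hj.trans hi') ∈ (c.verts.take (i + 1)).toFinset := by
        intro j hj
        rw [List.mem_toFinset, List.mem_take_iff_getElem]
        exact ⟨j, by omega, rfl⟩
      obtain ⟨F₂, G₂, hGG₂, h₂, hR₂, hno₂, ⟨N, hN, -⟩, u, hu, huv⟩ := h₁.exists_extend hΦ hinj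
        (v := c.verts[i + 1]) ⟨_, hmemI 0 (by omega)⟩
        (by
          intro hmem
          obtain ⟨j, hj, e⟩ := hget _ hmem
          have := (c.nodup.getElem_inj_iff).1 e
          omega) hR hIR hno hconv
        (by
          intro H hH
          obtain ⟨j, hj, hadj⟩ := hΨ H hH (i + 1) hi' (by omega)
          exact ⟨_, hmemI j hj, hadj⟩)
      refine ⟨F₂, G₂, hGG₁.trans hGG₂, h₂, hR₂, hno₂, fun _ => ⟨N, hN⟩, ?_⟩
      intro k hk hk1 hki
      rcases Nat.lt_succ_iff_lt_or_eq.1 hki with hki | rfl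
      · obtain ⟨j, hj, hadj⟩ := hadj k hk hk1 hki
        exact ⟨j, hj, hGG₂ hadj⟩
      · obtain ⟨j, hj, rfl⟩ := hget u hu
        exact ⟨j, hj, huv⟩
  obtain ⟨F', G', hGG', h', -, -, hne, hadj⟩ := key (c.verts.length - 1) (by omega)
  exact ⟨F', G', hGG', h', fun k hk hk1 => hadj k hk hk1 (by omega), hne (by omega)⟩

end BlockForest

/-! ### The lower bound on solutions, and the order given by a path. -/

/-- If every vertex is reachable from a vertex of `S`, then `G` has at least `|V| - |S|` edges. -/
theorem card_le_ncard_edgeSet_add_card {V : Type*} [Fintype V] (G : SimpleGraph V)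
    (S : Finset V) (hS : ∀ v, ∃ s ∈ S, G.Reachable s v) :
    Fintype.card V ≤ G.edgeSet.ncard + S.card := by
  classical
  rcases S.eq_empty_or_nonempty with rfl | ⟨s₀, hs₀⟩
  · have : IsEmpty V := ⟨fun v => by simpa using hS v⟩
    simp
  -- A star from `s₀` to the rest of `S` makes the graph connected with at most `|S| - 1` extra
  -- edges.
  set T : Finset (Sym2 V) := (S.erase s₀).image fun s => s(s₀, s)
  set G' := G ⊔ SimpleGraph.fromEdgeSet (T : Set (Sym2 V))
  have hreach : ∀ v, G'.Reachable s₀ v := by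
    intro v
    obtain ⟨s, hs, hv⟩ := hS v
    refine SimpleGraph.Reachable.trans ?_ (hv.mono le_sup_left)
    by_cases h : s = s₀
    · rw [h]
    · refine SimpleGraph.Adj.reachable (Or.inr ?_)
      rw [SimpleGraph.fromEdgeSet_adj]
      exact ⟨Finset.mem_coe.2 (Finset.mem_image.2 ⟨s, Finset.mem_erase.2 ⟨h, hs⟩, rfl⟩), Ne.symm h⟩
  have hconn : G'.Connected :=
    (SimpleGraph.connected_iff _).2 ⟨fun u v => (hreach u).symm.trans (hreach v), ⟨s₀⟩⟩
  have h1 := hconn.card_vert_le_card_edgeSet_add_one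
  rw [Nat.card_eq_fintype_card, Nat.card_coe_set_eq] at h1
  have h2 : G'.edgeSet.ncard ≤ G.edgeSet.ncard + T.card := by
    rw [SimpleGraph.edgeSet_sup]
    refine (Set.ncard_union_le _ _).trans (Nat.add_le_add_left ?_ _)
    rw [← Set.ncard_coe_finset T]
    exact Set.ncard_le_ncard (by rw [SimpleGraph.edgeSet_fromEdgeSet]; exact Set.sdiff_subset)
  have h3 : T.card ≤ S.card - 1 := Finset.card_image_le.trans (Finset.card_erase_of_mem hs₀).le
  have h4 : 0 < S.card := Finset.card_pos.2 ⟨s₀, hs₀⟩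
  omega

/-- A vertex next to a convex set extends it to a convex set. -/
theorem OrderConvex.insert_of_adjacent {V : Type*} [DecidableEq V] {f : V → ℤ}
    (hf : Function.Injective f) {I : Finset V} (hI : OrderConvex f I) {u v : V} (hu : u ∈ I)
    (huv : f v = f u + 1 ∨ f u = f v + 1) : OrderConvex f (insert v I) := by
  have aux : ∀ y, f y = f u → y ∈ insert v I := fun y h =>
    Finset.mem_insert_of_mem (hf h ▸ hu)
  intro x hx z hz y h1 h2
  rcases Finset.mem_insert.1 hx with rfl | hxI <;>
    rcases Finset.mem_insert.1 hz with rfl | hzI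
  · omega
  · by_cases h : f u < f y
    · exact Finset.mem_insert_of_mem (hI u hu z hzI y h h2)
    · exact aux y (by omega)
  · by_cases h : f y < f u
    · exact Finset.mem_insert_of_mem (hI x hxI u hu y h1 h)
    · exact aux y (by omega)
  · exact Finset.mem_insert_of_mem (hI x hxI z hzI y h1 h2)

/-- The linear orders in which all the initial segments of the constraints are intervals. -/
def admissibleOrders {V : Type*} [DecidableEq V] (σ : List (OrderedConstraint V)) :
    Set (V → ℤ) :=
  {f | Function.Injective f ∧ ∀ c ∈ σ, ∀ i, OrderConvex f (c.verts.take i).toFinset}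

/-- Adjacent vertices of the path get consecutive numbers, so adding a neighbour of an earlier
vertex keeps a prefix an interval. -/
theorem admissibleOrders_nonempty {V : Type*} [Fintype V] [DecidableEq V]
    {σ : List (OrderedConstraint V)} (hσ : σ ∈ pathInstances V) :
    (admissibleOrders σ).Nonempty := by
  obtain ⟨P, ⟨a, b, p, hp, hedges⟩, hsol⟩ := hσ
  set e := Fintype.equivFin V
  -- Vertices off the path get distinct negative numbers, clear of the positions on the path.
  set f : V → ℤ := fun v =>
    if v ∈ p.support then (p.support.idxOf v : ℤ) else -((e v : ℕ) : ℤ) - 1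
  have hinj : Function.Injective f := by
    intro u v h
    simp only [f] at h
    split_ifs at h with hu hv hv
    · exact (List.idxOf_inj hu).1 (by exact_mod_cast h)
    · omega
    · omega
    · exact e.injective (Fin.ext (by omega))
  have hvert : ∀ i ≤ p.length, f (p.getVert i) = i := by
    intro i hi
    have hm := p.getVert_mem_support i
    simp only [f, hm, if_true]
    rw [p.getVert_eq_support_getElem hi, hp.support_nodup.idxOf_getElem]
  have hadj : ∀ u v, P.Adj u v → f v = f u + 1 ∨ f u = f v + 1 := by
    intro u v huv
    have := hedges s(u, v) huv
    rw [SimpleGraph.Walk.mk_mem_edges_iff_exists] at this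
    obtain ⟨i, hi, h⟩ := this
    have h1 := hvert i hi.le
    have h2 := hvert (i + 1) hi
    rcases Sym2.eq_iff.1 h with ⟨rfl, rfl⟩ | ⟨rfl, rfl⟩ <;> rw [h1, h2] <;> simp
  refine ⟨f, hinj, fun c hc i => ?_⟩
  induction i with
  | zero =>
    intro x hx
    simp at hx
  | succ i ih =>
    by_cases hi : i < c.verts.length
    · rw [BlockForest.toFinset_take_succ hi]
      rcases Nat.eq_zero_or_pos i with rfl | hpos
      · intro x hx z hz y h1 h2
        simp only [List.take_zero, List.toFinset_nil, insert_empty_eq, Finset.mem_singleton]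
          at hx hz
        subst hx hz
        omega
      · obtain ⟨j, hj, h⟩ := hsol c hc i hi hpos
        refine ih.insert_of_adjacent hinj ?_ (hadj _ _ h)
        rw [List.mem_toFinset, List.mem_take_iff_getElem]
        exact ⟨j, by omega, rfl⟩
    · rw [List.take_of_length_le (by omega)] at ih ⊢
      exact ih

theorem mem_pathInstances_of_append {V : Type*} {σ τ : List (OrderedConstraint V)}
    (h : σ ++ τ ∈ pathInstances V) : σ ∈ pathInstances V := by
  obtain ⟨P, hP, hsol⟩ := h
  exact ⟨P, hP, fun c hc => hsol c (List.mem_append_left _ hc)⟩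

/-! ### The algorithm and its competitive ratio. -/

/-- The forest whose blocks are the single vertices. -/
noncomputable def BlockForest.discrete (V : Type*) [Fintype V] [DecidableEq V] [Nonempty V] :
    BlockForest V where
  nodes := ∅
  roots := Finset.univ.map ⟨singleton, Finset.singleton_injective⟩
  ch := fun _ => []
  anchor := fun X => Classical.epsilon (· ∈ X)
  anchor_singleton := fun v => by
    have := Classical.epsilon_spec (p := (· ∈ ({v} : Finset V))) ⟨v, Finset.mem_singleton_self v⟩
    exact Finset.mem_singleton.1 this
  anchor_mem := by simp
  two_le_ch := by simp
  ch_disj := by simp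
  mem_node := by simp
  ch_block := by simp
  root_block := by
    intro R hR
    obtain ⟨v, -, rfl⟩ := Finset.mem_map.1 hR
    exact Or.inr ⟨v, rfl⟩
  root_or_child := by simp
  parent_unique := by simp
  root_not_child := by simp
  root_disj := by
    intro R hR R' hR' hne
    obtain ⟨v, -, rfl⟩ := Finset.mem_map.1 hR
    obtain ⟨w, -, rfl⟩ := Finset.mem_map.1 hR'
    exact Finset.disjoint_singleton.2 fun h => hne (by rw [h])
  root_cover := fun v => ⟨{v}, Finset.mem_map.2 ⟨v, Finset.mem_univ v, rfl⟩, by simp⟩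
  node_le_root := by simp

/-- `G` is a possible state of the online algorithm after the constraints `σ`. -/
def IsGoodState {V : Type*} [Fintype V] [DecidableEq V] (σ : List (OrderedConstraint V))
    (G : SimpleGraph V) : Prop :=
  IsSolution σ G ∧ ∃ F : BlockForest V,
    F.Invariant (admissibleOrders σ) {H | IsSolution σ H} G ∧ (σ ≠ [] → F.nodes.Nonempty)

theorem isGoodState_nil {V : Type*} [Fintype V] [DecidableEq V] [Nonempty V] :
    IsGoodState ([] : List (OrderedConstraint V)) ⊥ := by
  refine ⟨by simp [IsSolution], BlockForest.discrete V, ⟨?_, ?_, ?_, ?_⟩, by simp⟩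
  · refine fun f _ => ⟨fun R hR => ?_, by simp [BlockForest.discrete]⟩
    obtain ⟨v, -, rfl⟩ := Finset.mem_map.1 hR
    intro x hx z hz y h1 h2
    rw [Finset.mem_singleton.1 hx] at h1
    rw [Finset.mem_singleton.1 hz] at h2
    omega
  · simp [BlockForest.Connects, BlockForest.discrete]
  · simp [BlockForest.weight, BlockForest.discrete]
  · intro H _ R hR x hx y hy
    obtain ⟨v, -, rfl⟩ := Finset.mem_map.1 hR
    rw [Finset.mem_singleton.1 hx, Finset.mem_singleton.1 hy]

theorem IsGoodState.exists_append {V : Type*} [Fintype V] [DecidableEq V]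
    {σ : List (OrderedConstraint V)} {G : SimpleGraph V} (h : IsGoodState σ G)
    {c : OrderedConstraint V} (hc : σ ++ [c] ∈ pathInstances V) :
    ∃ G', G ≤ G' ∧ IsGoodState (σ ++ [c]) G' := by
  obtain ⟨hsol, F, hF, -⟩ := h
  have hcm : c ∈ σ ++ [c] := by simp
  -- A further constraint can only shrink the sets of orders and of solutions, over which the
  -- invariant quantifies universally.
  have hF' : F.Invariant (admissibleOrders (σ ++ [c])) {H | IsSolution (σ ++ [c]) H} G :=
    ⟨fun f hf => hF.realizes f ⟨hf.1, fun d hd => hf.2 d (List.mem_append_left _ hd)⟩,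
      hF.connects, hF.cost,
      fun H hH => hF.reachable H fun d hd => hH d (List.mem_append_left _ hd)⟩
  obtain ⟨F', G', hGG', hF'', hsat, hne⟩ := hF'.exists_satisfiedBy (admissibleOrders_nonempty hc)
    (fun f hf => hf.1) c (fun f hf => hf.2 c hcm) (fun H hH => hH c hcm)
  refine ⟨G', hGG', ?_, F', hF'', fun _ => hne⟩
  intro d hd
  rcases List.mem_append.1 hd with hd | hd
  · intro i hi h1
    obtain ⟨j, hj, hadj⟩ := hsol d hd i hi h1
    exact ⟨j, hj, hGG' hadj⟩
  · rw [List.mem_singleton.1 hd]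
    exact hsat

/-- Here `k` is the number of roots. One unit of credit remains because a node exists, and one
anchor per root reaches every vertex in any solution. -/
theorem IsGoodState.exists_card {V : Type*} [Fintype V] [DecidableEq V] [Nonempty V]
    {σ : List (OrderedConstraint V)} {G : SimpleGraph V} (h : IsGoodState σ G) (hσ : σ ≠ []) :
    ∃ k, 1 ≤ k ∧ G.edgeSet.ncard + 1 + 2 * k ≤ 2 * Fintype.card V ∧
      ∀ H, IsSolution σ H → Fintype.card V ≤ H.edgeSet.ncard + k := by
  obtain ⟨-, F, hF, hne⟩ := h
  obtain ⟨N, hN⟩ := hne hσ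
  refine ⟨F.roots.card, ?_, ?_, fun H hH => ?_⟩
  · obtain ⟨R, hR, -⟩ := F.root_cover (Classical.arbitrary V)
    exact Finset.card_pos.2 ⟨R, hR⟩
  · have := hF.cost
    have := F.weight_pos hN
    omega
  · refine (card_le_ncard_edgeSet_add_card H (F.roots.image F.anchor) fun v => ?_).trans
      (Nat.add_le_add_left Finset.card_image_le _)
    obtain ⟨R, hR, hv⟩ := F.root_cover v
    exact ⟨F.anchor R, Finset.mem_image_of_mem _ hR, hF.reachable H hH R hR _
      (F.anchor_mem_of_block (F.root_block R hR)) v hv⟩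

theorem isSolution_top {V : Type*} (σ : List (OrderedConstraint V)) : IsSolution σ ⊤ := by
  intro c _ i hi h1
  refine ⟨0, h1, ?_⟩
  rw [SimpleGraph.top_adj]
  intro h
  have := c.nodup.getElem_inj_iff.1 h
  omega

open Classical in
/-- The graph held by the online algorithm, as a function of the reversed history: as long as
possible, it moves on to a good state. -/
noncomputable def onlineGraph {V : Type*} [Fintype V] [DecidableEq V] :
    List (OrderedConstraint V) → SimpleGraph V
  | [] => ⊥
  | c :: τ =>
    -- The choice depends on the history alone. The default `⊤` satisfies every constraint and is
    -- never reached on `pathInstances`.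
    if h : ∃ G', onlineGraph τ ≤ G' ∧ IsGoodState (c :: τ).reverse G' then h.choose else ⊤

/-- The online algorithm for constraints that can be satisfied by a path. -/
noncomputable def pathAlgorithm (V : Type*) [Fintype V] [DecidableEq V] : OnlineAlgorithm V where
  graph σ := onlineGraph σ.reverse
  graph_nil := rfl
  graph_le σ c := by
    rw [List.reverse_append, List.reverse_singleton, List.singleton_append, onlineGraph]
    split_ifs with h
    · exact h.choose_spec.1
    · exact le_top
  isSolution σ := by
    rcases List.eq_nil_or_concat σ with rfl | ⟨τ, c, rfl⟩
    · simp [IsSolution]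
    · rw [List.concat_eq_append, List.reverse_append, List.reverse_singleton,
        List.singleton_append, onlineGraph]
      split_ifs with h
      · simpa using h.choose_spec.2.1
      · exact isSolution_top _

theorem isGoodState_pathAlgorithm {V : Type*} [Fintype V] [DecidableEq V] [Nonempty V]
    (σ : List (OrderedConstraint V)) (hσ : σ ∈ pathInstances V) :
    IsGoodState σ ((pathAlgorithm V).graph σ) := by
  induction σ using List.reverseRecOn with
  | nil => exact isGoodState_nil
  | append_singleton σ c ih =>
    have hG := ih (mem_pathInstances_of_append hσ)
    have hex : ∃ G', onlineGraph σ.reverse ≤ G' ∧ IsGoodState (c :: σ.reverse).reverse G' := by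
      rw [List.reverse_cons, List.reverse_reverse]
      exact hG.exists_append hσ
    have e : (pathAlgorithm V).graph (σ ++ [c]) = hex.choose := by
      change onlineGraph (σ ++ [c]).reverse = _
      rw [List.reverse_append, List.reverse_singleton, List.singleton_append, onlineGraph,
        dif_pos hex]
    rw [e]
    simpa using hex.choose_spec.2

theorem theorem6 :
    ∃ A : (n : ℕ) → OnlineAlgorithm (Fin n), ∀ n : ℕ, 2 ≤ n →
      (∀ σ ∈ pathInstances (Fin n), (A n).cost σ ≤ 2 * n - 3) ∧
      (A n).IsCompetitiveOn 2 (pathInstances (Fin n)) := by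
  refine ⟨fun n => pathAlgorithm (Fin n), fun n hn => ?_⟩
  have : Nonempty (Fin n) := ⟨⟨0, by omega⟩⟩
  refine ⟨fun σ hσ => ?_, fun σ hσ hne => ?_⟩
  -- Before the first constraint there need not be a node, hence no leftover credit; but then no
  -- edge has been added either.
  · by_cases hne : σ = []
    · subst hne
      simp [OnlineAlgorithm.cost, OnlineAlgorithm.graph_nil]
    · obtain ⟨k, hk, hcost, -⟩ := (isGoodState_pathAlgorithm σ hσ).exists_card hne
      rw [Fintype.card_fin] at hcost
      change ((pathAlgorithm (Fin n)).graph σ).edgeSet.ncard ≤ _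
      omega
  · obtain ⟨k, hk, hcost, hopt⟩ := (isGoodState_pathAlgorithm σ hσ).exists_card hne
    obtain ⟨H, hH, hHopt⟩ : opt σ ∈ {k | ∃ G : SimpleGraph (Fin n),
        IsSolution σ G ∧ G.edgeSet.ncard = k} :=
      Nat.sInf_mem (by obtain ⟨P, -, hP⟩ := hσ; exact ⟨_, P, hP, rfl⟩)
    have := hopt H hH
    -- The cost is at most `2(n - k) - 1`, while `opt σ ≥ n - k`.
    have hlt : (pathAlgorithm (Fin n)).cost σ < 2 * opt σ := by
      rw [OnlineAlgorithm.cost]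
      omega
    exact_mod_cast hlt
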